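/- Let $\mathcal A$ be a unital associative complex algebra and let $T(T_+(\mathcal A))$, with $T_+(\mathcal A)=\bigoplus_{n\ge1}\mathcal A^{\otimes n}$, be its double tensor Hopf algebra: the product is the bar concatenation with unit $\mathbf 1$, and the coproduct is the multiplicative map given on words $w=a_1\cdots a_n$ by $$\Delta(w)=\sum_{S\subseteq[n]}w_S\otimes w_{J_1}|\cdots|w_{J_r},$$ where $J_1,\dots,J_r$ are the connected components (maximal intervals) of $[n]\setminus S$ in increasing order. Let $\epsilon$ be the counit. Let $\Delta_\prec$ and $\Delta_\succ$ be the parts of $\Delta$ in which $S$ contains, respectively does not contain, the first letter of $w$; they are extended by $\Delta_{\prec}(w|x)=\Delta_{\prec}(w)\Delta(x)$, $\Delta_{\succ}(w|x)=\Delta_{\succ}(w)\Delta(x)$ and $\Delta_\prec(\mathbf 1)=\Delta_\succ(\mathbf 1)=0$. For linear functionals $f,g$ on $T(T_+(\mathcal A))$ put $f*g=(f\otimes g)\Delta$, $f\prec g=(f\otimes g)\Delta_\prec$, $f\succ g=(f\otimes g)\Delta_\succ$ and $f\lhd g=f\prec g-g\succ f$. A character is a unital algebra morphism to $\mathbb C$;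 an infinitesimal character is a functional vanishing on $\mathbf 1$ and on all $w_1|\cdots|w_k$, $k\ge2$, $w_i\in T_+(\mathcal A)$. For an infinitesimal character $\alpha$ put $\exp^*(\alpha)=\sum_{n\ge0}\alpha^{*n}/n!$ and $\mathcal E_\succ(\alpha)=\sum_{n\ge0}\alpha^{\succ n}$, with $\alpha^{\succ0}=\epsilon$ and $\alpha^{\succ n}=\alpha^{\succ n-1}\succ\alpha$; put $e^{r_{\lhd\gamma}}(\alpha)=\sum_{n\ge0}\frac1{n!}r^{(n)}_{\lhd\gamma}(\alpha)$, with $r_{\lhd\gamma}(\alpha)=\alpha\lhd\gamma$. These sums are pointwise finite. Let $\Phi,\Psi$ be characters on $T(T_+(\mathcal A))$ and let $\beta$ be an infinitesimal character with $\Phi=\mathcal E_\succ(\beta)$. Then $\Psi$ has a convolution inverse $\Psi^{*-1}$, the functional $\Psi^{*-1}\succ\beta\prec\Psi:=(\Psi^{*-1}\succ\beta)\prec\Psi$ is an infinitesimal character, and $$\Phi\vdash\Psi:=\mathcal E_\succ\big(\Psi^{*-1}\succ\beta\prec\Psi\big)$$ is a character. Moreover: 1. $\Phi\vdash\Psi$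 extends the orthogonal convolution $\mu\vdash\nu$. Precisely, let $\mu,\nu$ be distributions, i.e. linear functionals on $\mathbb C[X]$ with value $1$ at $1$, let $a\neq b$ be two elements of a linear basis (alphabet) of $\mathcal A$, and suppose that $\Phi$ extends $\mu$ at $a$ and $\Psi$ extends $\nu$ at $b$; that is, for every word $w$ of length $n\ge0$ in letters of the alphabet, $\Phi(w)=\mu(X^n)$ if $w=a^{\otimes n}$ and $\Phi(w)=0$ if $w$ contains a letter other than $a$, and likewise for $\Psi,\nu,b$. Then, for a linear functional $\eta$ on $\mathbb C[X]$, $\eta$ is the orthogonal convolution $\mu\vdash\nu$ if and only if $\eta(X^n)=(\Phi\vdash\Psi)\big((a+b)^{\otimes n}\big)$ for all $n\ge0$. Here $\eta$ is called the orthogonal convolution $\mu\vdash\nu$ if there are a unital complex algebra $B$, linear functionals $\varphi,\psi$ on $B$ with $\varphi(1)=\psi(1)=1$, and $x,y\in B$ such that $\mu(X^n)=\varphi(x^n)$, $\nu(X^n)=\psi(y^n)$ and $\eta(X^n)=\varphi((x+y)^n)$ for all $n\ge0$, and such that the non-unital algebra $B_2$ generated by $y$ is orthogonal to the non-unital algebra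 $B_1$ generated by $x$ in the sense of Lenczewski: $\varphi(cz)=\varphi(zc)=0$ and $$\varphi(z_1a_1ca_2z_2)=\psi(c)\big(\varphi(z_1a_1a_2z_2)-\varphi(z_1a_1)\varphi(a_2z_2)\big)$$ for all $a_1,a_2\in B_1$, $c\in B_2$ and all $z,z_1,z_2$ in the unital algebra generated by $B_1\cup B_2$. 2. If $\Psi=\exp^*(\rho')$ for an infinitesimal character $\rho'$, then the series $e^{r_{\lhd\rho'}}(\beta)$ is pointwise finite and $$\Phi\vdash\Psi=\mathcal E_\succ\big(e^{r_{\lhd\rho'}}(\beta)\big).$$ -/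

import Mathlib

universe u v w

open scoped TensorProduct

noncomputable section

namespace DoubleTensor

/-! ### The double tensor algebra -/

section Algebra

variable (A : Type u) [AddCommGroup A] [Module ℂ A]

/-- `T₊(A) = ⨁_{n ≥ 1} A^{⊗ n}`; the summand with index `n` is `A^{⊗ (n + 1)}`. -/
abbrev TPlus : Type u := DirectSum ℕ fun n : ℕ => ⨂[ℂ]^(n + 1) A

/-- `T(T₊(A))`, whose product is the bar concatenation. -/
abbrev DT : Type u := TensorAlgebra ℂ (TPlus A)

/-- Linear functionals on `T(T₊(A))`. -/
abbrev Functional : Type u := DT A →ₗ[ℂ] ℂ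

/-- The word `a₁ ⋯ aₖ` as an element of `T(T₊(A))`; the empty word is the unit. -/
def word : (k : ℕ) → MultilinearMap ℂ (fun _ : Fin k => A) (DT A)
  | 0 => MultilinearMap.constOfIsEmpty ℂ _ 1
  | n + 1 => ((TensorAlgebra.ι ℂ).comp
      (DirectSum.lof ℂ ℕ (fun n : ℕ => ⨂[ℂ]^(n + 1) A) n)).compMultilinearMap
        (PiTensorProduct.tprod ℂ)

end Algebra

variable {A : Type u} [AddCommGroup A] [Module ℂ A]

/-- The subword `w_J` of `w = m₁ ⋯ mₙ` at the positions listed in `J`. -/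
def subword {n : ℕ} (m : Fin n → A) (J : List (Fin n)) : DT A :=
  word A J.length (fun p => m (J.get p))

/-- The elements of `S ⊆ [n]` in increasing order. -/
def positions {n : ℕ} (S : Finset (Fin n)) : List (Fin n) :=
  (List.finRange n).filter (fun i => i ∈ S)

/-- The connected components `J₁, …, J_r` of `[n] \ S` (its maximal runs of consecutive integers),
in increasing order. -/
def gaps {n : ℕ} (S : Finset (Fin n)) : List (List (Fin n)) :=
  (positions Sᶜ).splitBy (fun i j => decide (i.val + 1 = j.val))

theorem nodup_positions {n : ℕ} (S : Finset (Fin n)) : (positions S).Nodup :=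
  (List.nodup_finRange n).filter _

theorem mem_positions {n : ℕ} {S : Finset (Fin n)} {i : Fin n} : i ∈ positions S ↔ i ∈ S := by
  simp [positions]

theorem flatten_gaps {n : ℕ} (S : Finset (Fin n)) : (gaps S).flatten = positions Sᶜ :=
  List.flatten_splitBy _ _

/-- `w_{J₁} | ⋯ | w_{J_r}` for a list of lists of positions. -/
def barSubwords {n : ℕ} (m : Fin n → A) (L : List (List (Fin n))) : DT A :=
  (L.map (subword m)).prod

theorem subword_update_of_notMem {n : ℕ} [DecidableEq (Fin n)] (m : Fin n → A)
    (J : List (Fin n)) (i : Fin n) (hi : i ∉ J) (c : A) :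
    subword (Function.update m i c) J = subword m J := by
  unfold subword
  congr 1
  funext p
  have hp : J.get p ≠ i := fun h => hi (by rw [← h]; exact List.get_mem J p)
  exact Function.update_of_ne hp _ _

theorem subword_update_of_mem {n : ℕ} [DecidableEq (Fin n)] (J : List (Fin n))
    (hJ : J.Nodup) (i : Fin n) (hi : i ∈ J) :
    ∃ p : Fin J.length, ∀ (m : Fin n → A) (c : A), subword (Function.update m i c) J
      = word A J.length (Function.update (fun q => m (J.get q)) p c) := by
  obtain ⟨p, hp⟩ := List.get_of_mem hi
  refine ⟨p, fun m c => ?_⟩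
  unfold subword
  congr 1
  funext q
  by_cases h : q = p
  · subst h
    rw [hp, Function.update_self, Function.update_self]
  · have hne : J.get q ≠ i := fun e => h (hJ.injective_get (e.trans hp.symm))
    rw [Function.update_of_ne hne, Function.update_of_ne h]

theorem subword_update_add {n : ℕ} [DecidableEq (Fin n)] (m : Fin n → A) (J : List (Fin n))
    (hJ : J.Nodup) (i : Fin n) (hi : i ∈ J) (x y : A) :
    subword (Function.update m i (x + y)) J
      = subword (Function.update m i x) J + subword (Function.update m i y) J := by
  obtain ⟨p, hp⟩ := subword_update_of_mem (A := A) J hJ i hi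
  simp only [hp, MultilinearMap.map_update_add]

theorem subword_update_smul {n : ℕ} [DecidableEq (Fin n)] (m : Fin n → A) (J : List (Fin n))
    (hJ : J.Nodup) (i : Fin n) (hi : i ∈ J) (c : ℂ) (x : A) :
    subword (Function.update m i (c • x)) J = c • subword (Function.update m i x) J := by
  obtain ⟨p, hp⟩ := subword_update_of_mem (A := A) J hJ i hi
  simp only [hp, MultilinearMap.map_update_smul]

theorem barSubwords_update_of_notMem {n : ℕ} [DecidableEq (Fin n)] (m : Fin n → A)
    (L : List (List (Fin n))) (i : Fin n) (hi : i ∉ L.flatten) (c : A) :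
    barSubwords (Function.update m i c) L = barSubwords m L := by
  unfold barSubwords
  congr 1
  refine List.map_congr_left fun J hJ => subword_update_of_notMem m J i (fun h => hi ?_) c
  exact List.mem_flatten.2 ⟨J, hJ, h⟩

theorem barSubwords_update_add {n : ℕ} [DecidableEq (Fin n)] (m : Fin n → A)
    (L : List (List (Fin n))) (hL : L.flatten.Nodup) (i : Fin n) (hi : i ∈ L.flatten) (x y : A) :
    barSubwords (Function.update m i (x + y)) L
      = barSubwords (Function.update m i x) L + barSubwords (Function.update m i y) L := by
  induction L with
  | nil => simp at hi
  | cons J L ih =>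
    have hc : ∀ m : Fin n → A, barSubwords m (J :: L) = subword m J * barSubwords m L :=
      fun m => by simp [barSubwords]
    rw [List.flatten_cons] at hL hi
    obtain ⟨h1, h2, h3⟩ := List.nodup_append'.1 hL
    simp only [hc]
    by_cases hJ : i ∈ J
    · have hn : i ∉ L.flatten := fun h => h3 hJ h
      simp only [barSubwords_update_of_notMem m L i hn, subword_update_add m J h1 i hJ, add_mul]
    · have hm : i ∈ L.flatten := (List.mem_append.1 hi).resolve_left hJ
      simp only [subword_update_of_notMem m J i hJ, ih h2 hm, mul_add]

theorem barSubwords_update_smul {n : ℕ} [DecidableEq (Fin n)] (m : Fin n → A)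
    (L : List (List (Fin n))) (hL : L.flatten.Nodup) (i : Fin n) (hi : i ∈ L.flatten)
    (c : ℂ) (x : A) :
    barSubwords (Function.update m i (c • x)) L = c • barSubwords (Function.update m i x) L := by
  induction L with
  | nil => simp at hi
  | cons J L ih =>
    have hc : ∀ m : Fin n → A, barSubwords m (J :: L) = subword m J * barSubwords m L :=
      fun m => by simp [barSubwords]
    rw [List.flatten_cons] at hL hi
    obtain ⟨h1, h2, h3⟩ := List.nodup_append'.1 hL
    simp only [hc]
    by_cases hJ : i ∈ J
    · have hn : i ∉ L.flatten := fun h => h3 hJ h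
      simp only [barSubwords_update_of_notMem m L i hn, subword_update_smul m J h1 i hJ,
        smul_mul_assoc]
    · have hm : i ∈ L.flatten := (List.mem_append.1 hi).resolve_left hJ
      simp only [subword_update_of_notMem m J i hJ, ih h2 hm, mul_smul_comm]

/-- The term `w_S ⊗ (w_{J₁} | ⋯ | w_{J_r})` of the coproduct of a word `w` of length `n`. -/
def coprodTerm {n : ℕ} (S : Finset (Fin n)) :
    MultilinearMap ℂ (fun _ : Fin n => A) (DT A ⊗[ℂ] DT A) where
  toFun m := subword m (positions S) ⊗ₜ[ℂ] barSubwords m (gaps S)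
  map_update_add' m i x y := by
    have hg : (gaps S).flatten.Nodup := by rw [flatten_gaps]; exact nodup_positions _
    have hi : i ∈ (gaps S).flatten ↔ i ∉ S := by rw [flatten_gaps, mem_positions]; simp
    by_cases h : i ∈ S
    · have h' : i ∉ (gaps S).flatten := fun e => hi.1 e h
      simp only [barSubwords_update_of_notMem m _ i h',
        subword_update_add m _ (nodup_positions S) i (mem_positions.2 h), TensorProduct.add_tmul]
    · have h' : i ∉ positions S := fun e => h (mem_positions.1 e)
      simp only [subword_update_of_notMem m _ i h',
        barSubwords_update_add m _ hg i (hi.2 h), TensorProduct.tmul_add]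
  map_update_smul' m i c x := by
    have hg : (gaps S).flatten.Nodup := by rw [flatten_gaps]; exact nodup_positions _
    have hi : i ∈ (gaps S).flatten ↔ i ∉ S := by rw [flatten_gaps, mem_positions]; simp
    by_cases h : i ∈ S
    · have h' : i ∉ (gaps S).flatten := fun e => hi.1 e h
      simp only [barSubwords_update_of_notMem m _ i h',
        subword_update_smul m _ (nodup_positions S) i (mem_positions.2 h),
        TensorProduct.smul_tmul']
    · have h' : i ∉ positions S := fun e => h (mem_positions.1 e)
      simp only [subword_update_of_notMem m _ i h',
        barSubwords_update_smul m _ hg i (hi.2 h), TensorProduct.tmul_smul]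

variable (A) in
/-- The linear map on `T₊(A)` sending a word `w` of length `n` to the sum of the terms
`w_S ⊗ (w_{J₁} | ⋯ | w_{J_r})` over the subsets `S ⊆ [n]` belonging to `P n`. -/
def coprodOn (P : (n : ℕ) → Finset (Finset (Fin (n + 1)))) :
    TPlus A →ₗ[ℂ] DT A ⊗[ℂ] DT A :=
  DirectSum.toModule ℂ ℕ _ fun n => PiTensorProduct.lift (∑ S ∈ P n, coprodTerm S)

variable (A) in
/-- The coproduct: the multiplicative extension of `w ↦ ∑_{S ⊆ [n]} w_S ⊗ (w_{J₁} | ⋯ | w_{J_r})`. -/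
def coprod : DT A →ₐ[ℂ] DT A ⊗[ℂ] DT A :=
  TensorAlgebra.lift ℂ (coprodOn A fun _ => Finset.univ)

/-- The linear map `w ↦ !![0, δ w; 0, Δ w]` on `T₊(A)`. -/
def halfMatrix (δ : TPlus A →ₗ[ℂ] DT A ⊗[ℂ] DT A) :
    TPlus A →ₗ[ℂ] Matrix (Fin 2) (Fin 2) (DT A ⊗[ℂ] DT A) where
  toFun w := !![0, δ w; 0, coprod A (TensorAlgebra.ι ℂ w)]
  map_add' x y := by
    ext i j
    fin_cases i <;> fin_cases j <;> simp
  map_smul' c x := by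
    ext i j
    fin_cases i <;> fin_cases j <;> simp

/-- Given a linear map `δ` on `T₊(A)`, the linear map `D` on `T(T₊(A))` with `D(𝟏) = 0` and
`D(w | x) = δ(w) Δ(x)` for `w ∈ T₊(A)`, read off as the upper right entry of the algebra morphism
determined by `w ↦ !![0, δ w; 0, Δ w]`. -/
def extendHalf (δ : TPlus A →ₗ[ℂ] DT A ⊗[ℂ] DT A) : DT A →ₗ[ℂ] DT A ⊗[ℂ] DT A where
  toFun x := TensorAlgebra.lift ℂ (halfMatrix δ) x 0 1
  map_add' x y := by simp
  map_smul' c x := by simp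

theorem extendHalf_one (δ : TPlus A →ₗ[ℂ] DT A ⊗[ℂ] DT A) : extendHalf δ 1 = 0 := by
  simp [extendHalf]

theorem extendHalf_ι_mul (δ : TPlus A →ₗ[ℂ] DT A ⊗[ℂ] DT A) (w : TPlus A) (x : DT A) :
    extendHalf δ (TensorAlgebra.ι ℂ w * x) = δ w * coprod A x := by
  have key : TensorAlgebra.lift ℂ (halfMatrix δ) x 1 1 = coprod A x ∧
      TensorAlgebra.lift ℂ (halfMatrix δ) x 1 0 = 0 := by
    induction x using TensorAlgebra.induction with
    | algebraMap r => simp [Matrix.algebraMap_matrix_apply]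
    | ι w => simp [halfMatrix]
    | mul a b ha hb => simp [Matrix.mul_apply, Fin.sum_univ_two, ha.1, ha.2, hb.1, hb.2]
    | add a b ha hb => simp [ha.1, ha.2, hb.1, hb.2]
  have hw : ∀ k, halfMatrix δ w 0 k = ![0, δ w] k := fun k => by
    fin_cases k <;> simp [halfMatrix]
  simp [extendHalf, Matrix.mul_apply, Fin.sum_univ_two, key.1, hw]

variable (A) in
/-- `Δ_≺`: the sum over the `S` that contain the first letter of the first word. -/
def coprodLeft : DT A →ₗ[ℂ] DT A ⊗[ℂ] DT A :=
  extendHalf (coprodOn A fun _ => Finset.univ.filter fun S => 0 ∈ S)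

variable (A) in
/-- `Δ_≻`: the sum over the `S` that do not contain the first letter of the first word. -/
def coprodRight : DT A →ₗ[ℂ] DT A ⊗[ℂ] DT A :=
  extendHalf (coprodOn A fun _ => Finset.univ.filter fun S => 0 ∉ S)

/-! ### Functionals: convolution, half-shuffles, exponentials -/

variable (A) in
/-- The counit `ε`. -/
def counit : Functional A := (TensorAlgebra.algebraMapInv (R := ℂ) (M := TPlus A)).toLinearMap

/-- `f * g = m ∘ (f ⊗ g) ∘ Δ`. -/
def conv (f g : Functional A) : Functional A :=
  (LinearMap.mul' ℂ ℂ).comp ((TensorProduct.map f g).comp (coprod A).toLinearMap)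

/-- `f ≺ g = m ∘ (f ⊗ g) ∘ Δ_≺`. As `Δ_≺(𝟏) = 0`, one has `ε ≺ f = 0`, and `f ≺ ε = f`
whenever `f(𝟏) = 0`. -/
def halfLeft (f g : Functional A) : Functional A :=
  (LinearMap.mul' ℂ ℂ).comp ((TensorProduct.map f g).comp (coprodLeft A))

/-- `f ≻ g = m ∘ (f ⊗ g) ∘ Δ_≻`. As `Δ_≻(𝟏) = 0`, one has `f ≻ ε = 0`, and `ε ≻ f = f`
whenever `f(𝟏) = 0`. -/
def halfRight (f g : Functional A) : Functional A :=
  (LinearMap.mul' ℂ ℂ).comp ((TensorProduct.map f g).comp (coprodRight A))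

/-- Characters: unital algebra morphisms `T(T₊(A)) → ℂ`. -/
def IsCharacter (f : Functional A) : Prop :=
  f 1 = 1 ∧ ∀ x y : DT A, f (x * y) = f x * f y

/-- Infinitesimal characters: functionals vanishing at `𝟏` and at `w₁ | ⋯ | wₖ` for `k ≥ 2`. -/
def IsInfinitesimal (f : Functional A) : Prop :=
  f 1 = 0 ∧ ∀ l : List (TPlus A), 2 ≤ l.length → f ((l.map (TensorAlgebra.ι ℂ)).prod) = 0

/-- `g` is a two-sided inverse of `f` for the convolution product. -/
def IsConvInv (f g : Functional A) : Prop :=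
  conv f g = counit A ∧ conv g f = counit A

/-- The convolution inverse `f^{*-1}`. -/
def convInv (f : Functional A) : Functional A :=
  Classical.epsilon fun g => IsConvInv f g

/-- Pointwise, only finitely many members of the sequence are nonzero. -/
def LocallyFinite (F : ℕ → Functional A) : Prop :=
  ∀ x : DT A, (Function.support fun n => F n x).Finite

open Classical in
/-- The sum of a locally finite sequence of functionals. -/
def locSum (F : ℕ → Functional A) : Functional A :=
  if h : LocallyFinite F then
    { toFun := fun x => ∑ᶠ n, F n x
      map_add' := fun x y => by
        simp only [map_add]
        exact finsum_add_distrib (h x) (h y)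
      map_smul' := fun c x => by
        simp only [map_smul, RingHom.id_apply]
        exact (smul_finsum c fun n => F n x).symm }
  else 0

/-- `α^{* n}`. -/
def convPow (α : Functional A) : ℕ → Functional A
  | 0 => counit A
  | n + 1 => conv α (convPow α n)

/-- `exp^*(α) = ∑_{n ≥ 0} α^{* n} / n!`. -/
def convExp (α : Functional A) : Functional A :=
  locSum fun n => ((n.factorial : ℂ)⁻¹) • convPow α n

/-- `α^{≻ 0} = ε` and `α^{≻ (n + 1)} = α^{≻ n} ≻ α`. -/
def rightPow (α : Functional A) : ℕ → Functional A
  | 0 => counit A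
  | n + 1 => halfRight (rightPow α n) α

/-- The right half-shuffle exponential `ℰ_≻(α) = ∑_{n ≥ 0} α^{≻ n}`. -/
def rightExp (α : Functional A) : Functional A :=
  locSum (rightPow α)

/-- `θ_Ψ(α) = Ψ^{*-1} ≻ α ≺ Ψ`. -/
def adjoint (Ψ α : Functional A) : Functional A :=
  halfLeft (halfRight (convInv Ψ) α) Ψ

/-- `α ⊲ γ = α ≺ γ - γ ≻ α`. -/
def preLie (α γ : Functional A) : Functional A :=
  halfLeft α γ - halfRight γ α

/-- The `n`-th term `r_{⊲γ}^{(n)}(α) / n!` of `e^{r_{⊲γ}}(α)`. -/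
def preLieExpTerm (γ α : Functional A) (n : ℕ) : Functional A :=
  ((n.factorial : ℂ)⁻¹) • (fun α' : Functional A => preLie α' γ)^[n] α

/-- `e^{r_{⊲γ}}(α) = ∑_{n ≥ 0} r_{⊲γ}^{(n)}(α) / n!`. -/
def preLieExp (γ α : Functional A) : Functional A :=
  locSum (preLieExpTerm γ α)

/-! ### Distributions -/

/-- Algebraic distributions of one random variable: normalized linear functionals on `ℂ[X]`. -/
def IsDistribution (μ : Polynomial ℂ →ₗ[ℂ] ℂ) : Prop := μ 1 = 1

/-- With respect to an alphabet (linear basis) `e` of `A`, the functional `Φ` extends `μ` at the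
letter `e i`: a word in letters of the alphabet has the value `μ(Xⁿ)` if it is `(e i)^{⊗ n}`,
and `0` if it contains a letter other than `e i`. -/
def ExtendsAt {ι : Type w} (e : Module.Basis ι ℂ A) (i : ι) (μ : Polynomial ℂ →ₗ[ℂ] ℂ)
    (Φ : Functional A) : Prop :=
  ∀ (n : ℕ) (l : Fin n → ι),
    ((∀ k, l k = i) → Φ (word A n fun k => e (l k)) = μ (Polynomial.X ^ n)) ∧
    ((∃ k, l k ≠ i) → Φ (word A n fun k => e (l k)) = 0)

end DoubleTensor

namespace OrthogonalIndependence

variable {B : Type v} [Ring B] [Algebra ℂ B]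

/-- Lenczewski's orthogonality of the (non-unital) subalgebra `B₂` to the (non-unital) subalgebra
`B₁` with respect to a pair of functionals `(φ, ψ)`. -/
def IsOrthogonal (φ ψ : B →ₗ[ℂ] ℂ) (B₁ B₂ : NonUnitalSubalgebra ℂ B) : Prop :=
  (∀ b ∈ B₂, ∀ z ∈ Algebra.adjoin ℂ ((B₁ : Set B) ∪ (B₂ : Set B)),
    φ (b * z) = 0 ∧ φ (z * b) = 0) ∧
  (∀ a₁ ∈ B₁, ∀ a₂ ∈ B₁, ∀ b ∈ B₂,
    ∀ z₁ ∈ Algebra.adjoin ℂ ((B₁ : Set B) ∪ (B₂ : Set B)),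
    ∀ z₂ ∈ Algebra.adjoin ℂ ((B₁ : Set B) ∪ (B₂ : Set B)),
      φ (z₁ * a₁ * b * a₂ * z₂)
        = ψ b * (φ (z₁ * a₁ * a₂ * z₂) - φ (z₁ * a₁) * φ (a₂ * z₂)))

/-- `η = μ ⊢ ν`, the orthogonal convolution: `η` is the `φ`-distribution of `x + y` for a pair
`(x, y)` that is orthogonal with respect to normalized functionals `(φ, ψ)`, where `x` has
`φ`-distribution `μ` and `y` has `ψ`-distribution `ν`. -/
def IsOrthogonalConvolution (μ ν η : Polynomial ℂ →ₗ[ℂ] ℂ) : Prop :=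
  ∃ (B : Type v) (_ : Ring B) (_ : Algebra ℂ B) (φ ψ : B →ₗ[ℂ] ℂ) (x y : B),
    φ 1 = 1 ∧ ψ 1 = 1 ∧
    IsOrthogonal φ ψ (NonUnitalAlgebra.adjoin ℂ {x}) (NonUnitalAlgebra.adjoin ℂ {y}) ∧
    (∀ n : ℕ, μ (Polynomial.X ^ n) = φ (x ^ n)) ∧
    (∀ n : ℕ, ν (Polynomial.X ^ n) = ψ (y ^ n)) ∧
    (∀ n : ℕ, η (Polynomial.X ^ n) = φ ((x + y) ^ n))

end OrthogonalIndependence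

end

/-!
# Orthogonal convolution through half-shuffle exponentials

**Coassociativity.** Reading a word from the left, each letter is either selected or appended to
the current gap; `selSum` sums over these choices the product of the weights of the gaps and of
the selected subword. With the legs of the tensor product as weights it gives `Δ`, `Δ_≺` and `Δ_≻`
on words (`coprod_listWord`, `coprodLeft_cons`, `coprodRight_cons`). Selecting a subword of a
subword amounts to selecting a subword and then a subword of each gap (`selSum_selSum`). This one
identity gives the associativity of the convolution and the unshuffle relations
`(f ≺ g) ≺ h = f ≺ (g * h)`, `(f ≻ g) ≺ h = f ≻ (g ≺ h)`, `f ≻ (g ≻ h) = (f * g) ≻ h`.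

**Characters.** The coproducts respect the degree, so all series are pointwise finite, and products
commute with limits. A functional normalized at `𝟏` is inverted by its Neumann series. The left leg
of the coproduct of a word is a single word; hence the inverse of a character, and the solution
`ℰ_≻(α)` of `E = ε + E ≻ α`, satisfies the same equation as the character with its values on
`T₊(A)`, and equals that character by uniqueness. If `f` is a character and `α` is infinitesimal,
then `f ≻ α` is an `(ε, f)`-derivation, which makes `θ = Ψ^{*-1} ≻ β ≺ Ψ` infinitesimal.

**The pre-Lie exponential.** The relations show that `θ` is the unique functional vanishing at `𝟏`
with `Ψ ≻ θ = β ≺ Ψ` (`eq_adjoint_iff`), and that `L : α ↦ γ ≻ α` and `R : α ↦ α ≺ γ` commute.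
As `r_{⊲γ} = R - L`, one has `e^L e^{r_{⊲γ}} = e^R`, that is,
`exp^*(γ) ≻ e^{r_{⊲γ}}(β) = β ≺ exp^*(γ)`.

**Orthogonality.** On words in the letters `a`, `b` of the two distributions, `β` lives on powers
of `a` and `Ψ` on powers of `b`. From `Ψ ≻ θ = β ≺ Ψ` it follows that `θ` vanishes on words that
begin or end with `b`, and that inserting `b^k` between two letters `a` multiplies `θ` by `ν(X^k)`.
The words on which `ℰ_≻(θ)` is evaluated split into blocks weighted by `θ`, so the insertion of
`b^k` retains exactly the terms in which one block straddles the insertion; these terms add up to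
`E(u a a v) - E(u a) E(a v)`. This is Lenczewski's orthogonality relation on words
(`ConjugationData.isOrthogonalOnWords`), and it determines all mixed moments from `μ` and `ν`
(`IsOrthogonalOnWords.unique`). Every model therefore has the moments `E((a + b)^n)`, and the free
algebra on two generators, with functionals read off from `E` and `Ψ`, is a model.
-/

namespace DoubleTensor

/-! ### Maximal runs of a list -/

section SplitBy

variable {α β : Type*}

/-- The accumulators of the loop are a prefix of its output and of the first run. -/
theorem splitBy_loop_eq (r : α → α → Bool) (l : List α) (a : α) (g : List α)
    (gs : List (List α)) :
    List.splitBy.loop r l a g gs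
      = gs.reverse ++ (List.splitBy.loop r l a [] []).modifyHead (g.reverse ++ ·) := by
  induction l generalizing a g gs with
  | nil => simp [List.splitBy.loop]
  | cons b l ih =>
    cases h : r a b
    · simp only [List.splitBy.loop, h]
      rw [ih b [] ([a].reverse :: []), ih b [] (_ :: gs)]
      simp
    · simp only [List.splitBy.loop, h]
      rw [ih b [a] [], ih b (a :: g) gs]
      cases List.splitBy.loop r l b [] [] <;> simp

theorem splitBy_cons_cons (r : α → α → Bool) (a b : α) (l : List α) :
    List.splitBy r (a :: b :: l) = if r a b then (List.splitBy r (b :: l)).modifyHead (a :: ·)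
      else [a] :: List.splitBy r (b :: l) := by
  cases h : r a b
  · simp only [List.splitBy, List.splitBy.loop, h]
    rw [splitBy_loop_eq]
    cases List.splitBy.loop r l b [] [] <;> simp
  · simp only [List.splitBy, List.splitBy.loop, h]
    rw [splitBy_loop_eq]
    simp

theorem exists_splitBy_cons (r : α → α → Bool) (a : α) (l : List α) :
    ∃ J L, List.splitBy r (a :: l) = (a :: J) :: L := by
  induction l generalizing a with
  | nil => exact ⟨[], [], by simp [List.splitBy, List.splitBy.loop]⟩
  | cons b l ih =>
    obtain ⟨J, L, h⟩ := ih b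
    rw [splitBy_cons_cons, h]
    split
    · exact ⟨b :: J, L, rfl⟩
    · exact ⟨[], _, rfl⟩

theorem splitBy_map (r : α → α → Bool) (s : β → β → Bool) (f : α → β)
    (h : ∀ x y, s (f x) (f y) = r x y) (l : List α) :
    List.splitBy s (l.map f) = (List.splitBy r l).map (List.map f) := by
  induction l with
  | nil => simp
  | cons a l ih =>
    cases l with
    | nil => simp [List.splitBy, List.splitBy.loop]
    | cons b l =>
      simp only [List.map_cons] at ih ⊢
      rw [splitBy_cons_cons, splitBy_cons_cons, ih, h]
      cases List.splitBy r (b :: l) <;> split <;> simp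

end SplitBy

/-! ### Subsets of an interval and their gaps -/

section Gaps

variable {n : ℕ}

/-- The subset of `[n + 1]` obtained from `S ⊆ [n]` by prepending an unselected position. -/
def skipFirst (S : Finset (Fin n)) : Finset (Fin (n + 1)) := S.map (Fin.succEmb n)

/-- The subset of `[n + 1]` obtained from `S ⊆ [n]` by prepending a selected position. -/
def takeFirst (S : Finset (Fin n)) : Finset (Fin (n + 1)) := insert 0 (S.map (Fin.succEmb n))

theorem positions_skipFirst (S : Finset (Fin n)) :
    positions (skipFirst S) = (positions S).map Fin.succ := by
  simp [positions, skipFirst, List.finRange_succ, List.filter_map, Function.comp_def]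

theorem positions_takeFirst (S : Finset (Fin n)) :
    positions (takeFirst S) = 0 :: (positions S).map Fin.succ := by
  simp [positions, takeFirst, List.finRange_succ, List.filter_map, Function.comp_def]

theorem compl_skipFirst (S : Finset (Fin n)) : (skipFirst S)ᶜ = takeFirst Sᶜ := by
  ext i
  cases i using Fin.cases <;> simp [skipFirst, takeFirst]

theorem compl_takeFirst (S : Finset (Fin n)) : (takeFirst S)ᶜ = skipFirst Sᶜ := by
  ext i
  cases i using Fin.cases <;> simp [skipFirst, takeFirst]

/-- Separates from a list of runs of positions the run starting at the first position, which is
taken to be empty if there is none. -/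
def splitHead : List (List (Fin n)) → List (Fin n) × List (List (Fin n))
  | (i :: J) :: L => if i.val = 0 then (i :: J, L) else ([], (i :: J) :: L)
  | L => ([], L)

theorem gaps_takeFirst (S : Finset (Fin n)) :
    gaps (takeFirst S) = (gaps S).map (List.map Fin.succ) := by
  rw [gaps, compl_takeFirst, positions_skipFirst]
  exact splitBy_map _ _ _ (by simp) _

/-- An unselected first position extends the gap that starts right after it, or forms a gap of its
own if the next position is selected. -/
theorem gaps_skipFirst (S : Finset (Fin n)) :
    gaps (skipFirst S) = (0 :: (splitHead (gaps S)).1.map Fin.succ) ::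
      (splitHead (gaps S)).2.map (List.map Fin.succ) := by
  have hs := splitBy_map (fun i j : Fin n => decide (i.val + 1 = j.val))
    (fun i j => decide (i.val + 1 = j.val)) Fin.succ (by simp) (positions Sᶜ)
  rw [gaps, compl_skipFirst, positions_takeFirst, gaps]
  cases hp : positions Sᶜ with
  | nil => simp [splitHead, List.splitBy, List.splitBy.loop]
  | cons i P =>
    rw [hp] at hs
    obtain ⟨J, L, h⟩ :=
      exists_splitBy_cons (fun i j : Fin n => decide (i.val + 1 = j.val)) i P
    rw [List.map_cons] at hs ⊢
    rw [splitBy_cons_cons, hs, h]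
    by_cases h : i.val = 0
    · simp [splitHead, h]
    · simp [splitHead, h]

theorem mem_takeFirst_zero (S : Finset (Fin n)) : 0 ∈ takeFirst S := by simp [takeFirst]

theorem notMem_skipFirst_zero (S : Finset (Fin n)) : 0 ∉ skipFirst S := by simp [skipFirst]

theorem sum_mem_zero {M : Type*} [AddCommMonoid M] (f : Finset (Fin (n + 1)) → M) :
    ∑ S ∈ Finset.univ.filter (fun S : Finset (Fin (n + 1)) => 0 ∈ S), f S
      = ∑ S : Finset (Fin n), f (takeFirst S) := by
  symm
  refine Finset.sum_nbij' takeFirst (fun S => Finset.univ.filter fun i => i.succ ∈ S)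
    ?_ ?_ ?_ ?_ ?_
  · simp [mem_takeFirst_zero]
  · simp
  · intro S _; ext i; simp [takeFirst]
  · intro S hS
    ext i
    cases i using Fin.cases
    · simpa [takeFirst, eq_comm] using hS
    · simp [takeFirst]
  · simp

theorem sum_notMem_zero {M : Type*} [AddCommMonoid M] (f : Finset (Fin (n + 1)) → M) :
    ∑ S ∈ Finset.univ.filter (fun S : Finset (Fin (n + 1)) => 0 ∉ S), f S
      = ∑ S : Finset (Fin n), f (skipFirst S) := by
  symm
  refine Finset.sum_nbij' skipFirst (fun S => Finset.univ.filter fun i => i.succ ∈ S)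
    ?_ ?_ ?_ ?_ ?_
  · simp [notMem_skipFirst_zero]
  · simp
  · intro S _; ext i; simp [skipFirst]
  · intro S hS
    ext i
    cases i using Fin.cases
    · simpa [skipFirst, eq_comm] using hS
    · simp [skipFirst]
  · simp

theorem sum_finset_succ {M : Type*} [AddCommMonoid M] (f : Finset (Fin (n + 1)) → M) :
    ∑ S, f S = (∑ S : Finset (Fin n), f (takeFirst S)) + ∑ S : Finset (Fin n), f (skipFirst S) := by
  rw [← sum_mem_zero, ← sum_notMem_zero, Finset.sum_filter_add_sum_filter_not]

end Gaps

/-! ### Sums over the subwords of a word -/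

section SelSum

variable {α R : Type*}

/-- The sum over all subwords `s` of a word, with gaps `g₀, g₁, …, g_r` (empty ones included), of
`c' g₀ * c g₁ * ⋯ * c g_r * k s`: the word is read from the left, each letter being selected or
appended to the current gap. -/
def selSum [Semiring R] : (k c c' : List α → R) → List α → R
  | k, _, c', [] => c' [] * k []
  | k, c, c', a :: l =>
    c' [] * selSum (fun s => k (a :: s)) c c l + selSum k c (fun s => c' (a :: s)) l

variable [Ring R]

/-- The recursive sum over the selections in a word is the sum over all sets of positions. -/
theorem selSum_eq_sum_subsets (c : List α → R) (hc : c [] = 1) {n : ℕ} (m : Fin n → α)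
    (k c' : List α → R) :
    selSum k c c' (List.ofFn m) = ∑ S : Finset (Fin n),
      c' ((splitHead (gaps S)).1.map m)
        * ((splitHead (gaps S)).2.map fun J => c (J.map m)).prod * k ((positions S).map m) := by
  have hprod : ∀ {n : ℕ} (m : Fin n → α) (S : Finset (Fin n)),
      c ((splitHead (gaps S)).1.map m) * ((splitHead (gaps S)).2.map fun J => c (J.map m)).prod
        = ((gaps S).map fun J => c (J.map m)).prod := by
    intro n m S
    have hnil := List.nil_notMem_splitBy (fun i j : Fin n => decide (i.val + 1 = j.val))
      (positions Sᶜ)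
    change [] ∉ gaps S at hnil
    match gaps S, hnil with
    | [], _ => simp [splitHead, hc]
    | [] :: L, h => simp at h
    | (i :: J) :: L, _ =>
      by_cases h : i.val = 0 <;> simp [splitHead, h, hc]
  induction n generalizing k c' with
  | zero =>
    simp [selSum, gaps, positions, splitHead]
  | succ n ih =>
    rw [List.ofFn_succ, selSum, ih, ih, sum_finset_succ, Finset.mul_sum]
    congr 1
    · refine Finset.sum_congr rfl fun S _ => ?_
      have h0 : (splitHead (gaps (takeFirst S))) = ([], gaps (takeFirst S)) := by
        rw [gaps_takeFirst]
        rcases gaps S with _ | ⟨_ | ⟨i, J⟩, L⟩ <;> simp [splitHead]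
      rw [h0, hprod, gaps_takeFirst, positions_takeFirst]
      simp [Function.comp_def, mul_assoc]
    · refine Finset.sum_congr rfl fun S _ => ?_
      rw [gaps_skipFirst, positions_skipFirst]
      simp [splitHead, Function.comp_def, mul_assoc]

end SelSum

/-! ### The coproduct of a word -/

section Words

variable {A : Type u} [AddCommGroup A] [Module ℂ A]

/-- The word `a₁ ⋯ aₙ` of a list of letters; the empty list gives the unit. -/
noncomputable def listWord (l : List A) : DT A := word A l.length l.get

/-- The element `w₁ | ⋯ | wₖ` of a list of words. -/
noncomputable def barWord (L : List (List A)) : DT A := (L.map listWord).prod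

@[simp] theorem listWord_nil : listWord ([] : List A) = 1 := by
  simp [listWord, word]

@[simp] theorem barWord_nil : barWord ([] : List (List A)) = 1 := by simp [barWord]

@[simp] theorem barWord_cons (l : List A) (L : List (List A)) :
    barWord (l :: L) = listWord l * barWord L := by simp [barWord]

theorem barWord_append (L L' : List (List A)) :
    barWord (L ++ L') = barWord L * barWord L' := by simp [barWord]

theorem word_eq_listWord_of_length (l : List A) {n : ℕ} (h : l.length = n) (m : Fin n → A)
    (hm : ∀ p : Fin n, m p = l.get (p.cast h.symm)) : word A n m = listWord l := by
  subst h
  rw [listWord]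
  congr 1
  funext p
  exact hm p

theorem word_eq_listWord {n : ℕ} (m : Fin n → A) : word A n m = listWord (List.ofFn m) :=
  word_eq_listWord_of_length _ (by simp) _ (by simp)

theorem subword_eq_listWord {n : ℕ} (m : Fin n → A) (J : List (Fin n)) :
    subword m J = listWord (J.map m) :=
  word_eq_listWord_of_length _ (by simp) _ (by simp)

theorem barSubwords_eq_barWord {n : ℕ} (m : Fin n → A) (L : List (List (Fin n))) :
    barSubwords m L = barWord (L.map (List.map m)) := by
  simp only [barSubwords, barWord, List.map_map, Function.comp_def, ← subword_eq_listWord]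

theorem ι_lof_tprod {n : ℕ} (m : Fin (n + 1) → A) :
    TensorAlgebra.ι ℂ (DirectSum.lof ℂ ℕ (fun n : ℕ => ⨂[ℂ]^(n + 1) A) n
      (PiTensorProduct.tprod ℂ m)) = listWord (List.ofFn m) := by
  rw [← word_eq_listWord]; rfl

theorem exists_ofFn_eq_cons {α : Type*} (a : α) (l : List α) :
    ∃ (n : ℕ) (m : Fin (n + 1) → α), List.ofFn m = a :: l :=
  ⟨l.length, (a :: l).get, List.ofFn_get _⟩

theorem TPlus_induction {p : TPlus A → Prop} (zero : p 0)
    (add : ∀ x y, p x → p y → p (x + y)) (smul : ∀ (c : ℂ) x, p x → p (c • x))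
    (tprod : ∀ (n : ℕ) (m : Fin (n + 1) → A), p (DirectSum.lof ℂ ℕ (fun n : ℕ => ⨂[ℂ]^(n + 1) A) n
      (PiTensorProduct.tprod ℂ m))) (x : TPlus A) : p x := by
  induction x using DirectSum.induction_on with
  | zero => exact zero
  | of n x =>
    change p (DirectSum.lof ℂ ℕ (fun n : ℕ => ⨂[ℂ]^(n + 1) A) n x)
    induction x using PiTensorProduct.induction_on with
    | smul_tprod c m => rw [map_smul]; exact smul _ _ (tprod n m)
    | add x y hx hy => rw [map_add]; exact add _ _ hx hy
  | add x y hx hy => exact add x y hx hy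

/-- A nonempty word belongs to `T₊(A)`. -/
theorem listWord_mem_range_ι (a : A) (l : List A) :
    ∃ w : TPlus A, listWord (a :: l) = TensorAlgebra.ι ℂ w := by
  obtain ⟨n, m, h⟩ := exists_ofFn_eq_cons a l
  exact ⟨_, by rw [← h, ← ι_lof_tprod m]⟩

theorem span_barWord :
    Submodule.span ℂ (Set.range (barWord : List (List A) → DT A)) = ⊤ := by
  rw [eq_top_iff]
  rintro x -
  have hmul : ∀ x ∈ Submodule.span ℂ (Set.range (barWord : List (List A) → DT A)),
      ∀ y ∈ Submodule.span ℂ (Set.range (barWord : List (List A) → DT A)),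
      x * y ∈ Submodule.span ℂ (Set.range (barWord : List (List A) → DT A)) := by
    intro x hx y hy
    have h := Submodule.mul_mem_mul hx hy
    rw [Submodule.span_mul_span] at h
    refine Submodule.span_mono ?_ h
    rintro _ ⟨_, ⟨L, rfl⟩, _, ⟨L', rfl⟩, rfl⟩
    exact ⟨L ++ L', barWord_append L L'⟩
  induction x using TensorAlgebra.induction with
  | algebraMap r =>
    rw [Algebra.algebraMap_eq_smul_one]
    exact Submodule.smul_mem _ _ (Submodule.subset_span ⟨[], by simp⟩)
  | ι w =>
    induction w using TPlus_induction with
    | zero => simp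
    | add x y hx hy => rw [map_add]; exact add_mem hx hy
    | smul c x hx => rw [map_smul]; exact Submodule.smul_mem _ _ hx
    | tprod n m =>
      rw [ι_lof_tprod]
      exact Submodule.subset_span ⟨[List.ofFn m], by simp⟩
  | mul x y hx hy => exact hmul x hx y hy
  | add x y hx hy => exact add_mem hx hy

/-- Induction along the bar concatenation by nonempty words. -/
theorem DT_induction {p : DT A → Prop} (one : p 1) (add : ∀ x y, p x → p y → p (x + y))
    (smul : ∀ (c : ℂ) x, p x → p (c • x))
    (word_mul : ∀ (a : A) (l : List A) (x : DT A), p x → p (listWord (a :: l) * x))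
    (x : DT A) : p x := by
  have hx : x ∈ Submodule.span ℂ (Set.range (barWord : List (List A) → DT A)) := by
    rw [span_barWord]; trivial
  induction hx using Submodule.span_induction with
  | mem x hx =>
    obtain ⟨L, rfl⟩ := hx
    induction L with
    | nil => simpa using one
    | cons l L ih =>
      cases l with
      | nil => simpa using ih
      | cons a l => rw [barWord_cons]; exact word_mul a l _ ih
  | zero => simpa using smul 0 1 one
  | add x y _ _ hx hy => exact add x y hx hy
  | smul c x _ hx => exact smul c x hx

theorem linearMap_ext_barWord {M : Type*} [AddCommMonoid M] [Module ℂ M] {f g : DT A →ₗ[ℂ] M}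
    (h : ∀ L : List (List A), f (barWord L) = g (barWord L)) : f = g :=
  LinearMap.ext_on_range (v := (barWord : List (List A) → DT A)) span_barWord h

theorem algHom_ext_listWord {R : Type*} [Semiring R] [Algebra ℂ R] {f g : DT A →ₐ[ℂ] R}
    (h : ∀ (a : A) (l : List A), f (listWord (a :: l)) = g (listWord (a :: l))) : f = g := by
  refine AlgHom.toLinearMap_injective (linearMap_ext_barWord fun L => ?_)
  induction L with
  | nil => simp
  | cons l L ih =>
    cases l with
    | nil => simpa using ih
    | cons a l =>
      simp only [AlgHom.toLinearMap_apply, barWord_cons, map_mul] at ih ⊢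
      rw [ih, h]

/-- `s ↦ s ⊗ 1` on words. -/
noncomputable def leftLeg (s : List A) : DT A ⊗[ℂ] DT A := listWord s ⊗ₜ 1

/-- `g ↦ 1 ⊗ g` on words. -/
noncomputable def rightLeg (g : List A) : DT A ⊗[ℂ] DT A := 1 ⊗ₜ listWord g

theorem prod_map_rightLeg (L : List (List A)) :
    (L.map rightLeg).prod = (1 : DT A) ⊗ₜ[ℂ] barWord L := by
  induction L with
  | nil => simp [Algebra.TensorProduct.one_def]
  | cons l L ih => simp [ih, rightLeg]

theorem coprodOn_lof_tprod (P : (n : ℕ) → Finset (Finset (Fin (n + 1)))) {n : ℕ}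
    (m : Fin (n + 1) → A) :
    coprodOn A P (DirectSum.lof ℂ ℕ (fun n : ℕ => ⨂[ℂ]^(n + 1) A) n (PiTensorProduct.tprod ℂ m))
      = ∑ S ∈ P n, listWord ((positions S).map m) ⊗ₜ[ℂ] barWord ((gaps S).map (List.map m)) := by
  simp [coprodOn, coprodTerm, subword_eq_listWord, barSubwords_eq_barWord]

/-- The sum over the selections in a word `m`, when a word `t` has been selected and a word `g` is
the current gap already. -/
theorem selSum_legs {n : ℕ} (m : Fin n → A) (t g : List A) :
    selSum (fun s => leftLeg (t ++ s)) rightLeg (fun s => rightLeg (g ++ s)) (List.ofFn m)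
      = ∑ S : Finset (Fin n), listWord (t ++ (positions S).map m) ⊗ₜ[ℂ]
        barWord ((g ++ (splitHead (gaps S)).1.map m) ::
          (splitHead (gaps S)).2.map (List.map m)) := by
  rw [selSum_eq_sum_subsets _ (by simp [rightLeg, Algebra.TensorProduct.one_def])]
  refine Finset.sum_congr rfl fun S _ => ?_
  have := prod_map_rightLeg (A := A) ((splitHead (gaps S)).2.map (List.map m))
  rw [List.map_map] at this
  simp only [Function.comp_def] at this
  rw [this]
  simp [rightLeg, leftLeg]

theorem coprodOn_mem_zero {n : ℕ} (m : Fin (n + 1) → A) :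
    coprodOn A (fun _ => Finset.univ.filter fun S => 0 ∈ S)
      (DirectSum.lof ℂ ℕ (fun n : ℕ => ⨂[ℂ]^(n + 1) A) n (PiTensorProduct.tprod ℂ m))
      = selSum (fun s => leftLeg (m 0 :: s)) rightLeg rightLeg (List.ofFn (fun i => m i.succ)) := by
  have := selSum_legs (fun i => m i.succ) [m 0] []
  simp only [List.cons_append, List.nil_append] at this
  rw [this, coprodOn_lof_tprod, sum_mem_zero]
  refine Finset.sum_congr rfl fun S _ => ?_
  rw [positions_takeFirst, gaps_takeFirst]
  congr 1
  · simp [Function.comp_def]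
  · have hnil := List.nil_notMem_splitBy (fun i j : Fin n => decide (i.val + 1 = j.val))
      (positions Sᶜ)
    change [] ∉ gaps S at hnil
    match gaps S, hnil with
    | [], _ => simp [splitHead]
    | [] :: L, h => simp at h
    | (i :: J) :: L, _ =>
      by_cases h : i.val = 0 <;> simp [splitHead, h, Function.comp_def]

theorem coprodOn_notMem_zero {n : ℕ} (m : Fin (n + 1) → A) :
    coprodOn A (fun _ => Finset.univ.filter fun S => 0 ∉ S)
      (DirectSum.lof ℂ ℕ (fun n : ℕ => ⨂[ℂ]^(n + 1) A) n (PiTensorProduct.tprod ℂ m))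
      = selSum leftLeg rightLeg (fun g => rightLeg (m 0 :: g)) (List.ofFn (fun i => m i.succ)) := by
  have := selSum_legs (fun i => m i.succ) [] [m 0]
  simp only [List.cons_append, List.nil_append] at this
  rw [this, coprodOn_lof_tprod, sum_notMem_zero]
  refine Finset.sum_congr rfl fun S _ => ?_
  rw [positions_skipFirst, gaps_skipFirst]
  simp [Function.comp_def]

theorem coprodLeft_cons_mul (a : A) (l : List A) (x : DT A) :
    coprodLeft A (listWord (a :: l) * x)
      = selSum (fun s => leftLeg (a :: s)) rightLeg rightLeg l * coprod A x := by
  obtain ⟨n, m, h⟩ := exists_ofFn_eq_cons a l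
  rw [← h, ← ι_lof_tprod m, coprodLeft, extendHalf_ι_mul, coprodOn_mem_zero]
  rw [List.ofFn_succ, List.cons.injEq] at h
  rw [← h.1, ← h.2]

theorem coprodRight_cons_mul (a : A) (l : List A) (x : DT A) :
    coprodRight A (listWord (a :: l) * x)
      = selSum leftLeg rightLeg (fun g => rightLeg (a :: g)) l * coprod A x := by
  obtain ⟨n, m, h⟩ := exists_ofFn_eq_cons a l
  rw [← h, ← ι_lof_tprod m, coprodRight, extendHalf_ι_mul, coprodOn_notMem_zero]
  rw [List.ofFn_succ, List.cons.injEq] at h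
  rw [← h.1, ← h.2]

theorem coprodLeft_cons (a : A) (l : List A) :
    coprodLeft A (listWord (a :: l)) = selSum (fun s => leftLeg (a :: s)) rightLeg rightLeg l := by
  simpa using coprodLeft_cons_mul a l 1

theorem coprodRight_cons (a : A) (l : List A) :
    coprodRight A (listWord (a :: l))
      = selSum leftLeg rightLeg (fun g => rightLeg (a :: g)) l := by
  simpa using coprodRight_cons_mul a l 1

theorem coprod_listWord (l : List A) :
    coprod A (listWord l) = selSum leftLeg rightLeg rightLeg l := by
  cases l with
  | nil => simp [selSum, leftLeg, rightLeg, Algebra.TensorProduct.one_def]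
  | cons a l =>
    have hR : rightLeg ([] : List A) = 1 := by simp [rightLeg, Algebra.TensorProduct.one_def]
    rw [selSum, hR, one_mul, ← coprodLeft_cons, ← coprodRight_cons]
    obtain ⟨n, m, h⟩ := exists_ofFn_eq_cons a l
    have h1 := extendHalf_ι_mul (coprodOn A fun _ => Finset.univ.filter fun S => 0 ∈ S)
      (DirectSum.lof ℂ ℕ (fun n : ℕ => ⨂[ℂ]^(n + 1) A) n (PiTensorProduct.tprod ℂ m)) 1
    have h2 := extendHalf_ι_mul (coprodOn A fun _ => Finset.univ.filter fun S => 0 ∉ S)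
      (DirectSum.lof ℂ ℕ (fun n : ℕ => ⨂[ℂ]^(n + 1) A) n (PiTensorProduct.tprod ℂ m)) 1
    rw [mul_one, ι_lof_tprod, h, map_one, mul_one] at h1 h2
    rw [coprodLeft, coprodRight, h1, h2, ← h, ← ι_lof_tprod, coprod, TensorAlgebra.lift_ι_apply]
    simp only [coprodOn_lof_tprod, Finset.sum_filter_add_sum_filter_not]

theorem coprod_listWord_cons (a : A) (l : List A) :
    coprod A (listWord (a :: l))
      = coprodLeft A (listWord (a :: l)) + coprodRight A (listWord (a :: l)) := by
  rw [coprod_listWord, coprodLeft_cons, coprodRight_cons, selSum]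
  simp [rightLeg, ← Algebra.TensorProduct.one_def]

end Words

/-! ### Linearity and composition of sums over subwords -/

section SelSumAlgebra

variable {α R S : Type*} [Ring R] [Ring S]

theorem selSum_add_left (k₁ k₂ c c' : List α → R) (l : List α) :
    selSum (fun s => k₁ s + k₂ s) c c' l = selSum k₁ c c' l + selSum k₂ c c' l := by
  induction l generalizing k₁ k₂ c' with
  | nil => simp [selSum, mul_add]
  | cons a l ih => simp only [selSum, ih, mul_add]; abel

theorem selSum_mul_left (x : R) (k c c' : List α → R) (hc : ∀ l, Commute x (c l))
    (hc' : ∀ l, Commute x (c' l)) (l : List α) :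
    selSum (fun s => x * k s) c c' l = x * selSum k c c' l := by
  induction l generalizing k c' with
  | nil => simp only [selSum, ← mul_assoc, (hc' _).eq]
  | cons a l ih =>
    simp only [selSum]
    rw [ih _ _ hc, ih _ _ (fun l => hc' (a :: l)), mul_add, ← mul_assoc, ← mul_assoc, (hc' _).eq]

theorem selSum_add_gap (k c c₁ c₂ : List α → R) (l : List α) :
    selSum k c (fun s => c₁ s + c₂ s) l = selSum k c c₁ l + selSum k c c₂ l := by
  induction l generalizing c₁ c₂ with
  | nil => simp [selSum, add_mul]
  | cons a l ih => simp only [selSum, ih, add_mul]; abel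

theorem selSum_mul_gap (x : R) (k c c' : List α → R) (l : List α) :
    selSum k c (fun s => x * c' s) l = x * selSum k c c' l := by
  induction l generalizing c' with
  | nil => simp only [selSum, mul_assoc]
  | cons a l ih => simp only [selSum, ih, mul_add, mul_assoc]

theorem selSum_zero_left (c c' : List α → R) (l : List α) : selSum (fun _ => 0) c c' l = 0 := by
  induction l generalizing c' with
  | nil => simp [selSum]
  | cons a l ih => simp [selSum, ih]

theorem selSum_zero_gap (k c : List α → R) (l : List α) : selSum k c (fun _ => 0) l = 0 := by
  induction l with
  | nil => simp [selSum]
  | cons a l ih => simp [selSum, ih]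

/-- If the gap weight is the indicator of the empty word, only the full subword contributes. -/
theorem selSum_indicator_gap (k d : List α → R) (h1 : d [] = 1) (h0 : ∀ a l, d (a :: l) = 0)
    (l : List α) : selSum k d d l = k l := by
  induction l generalizing k with
  | nil => simp [selSum, h1]
  | cons a l ih => simp [selSum, h1, h0, ih, selSum_zero_gap]

/-- If the subword weight is the indicator of the empty word, only the empty subword
contributes. -/
theorem selSum_indicator_left (d c c' : List α → R) (h1 : d [] = 1)
    (h0 : ∀ a l, d (a :: l) = 0) (l : List α) : selSum d c c' l = c' l := by
  induction l generalizing c' with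
  | nil => simp [selSum, h1]
  | cons a l ih => simp [selSum, h0, ih, selSum_zero_left]

/-- Additive maps that convert the multiplication by a gap weight into the multiplication by another
gap weight carry one sum over subwords to another; `F` treats the gap at which the reading starts,
`G` what follows. -/
theorem map_selSum {R S : Type*} [Ring R] [Ring S] (G : R →+ S) (k c : List α → R)
    (d : List α → S) (hG : ∀ l y, G (c l * y) = d l * G y) (F : R →+ S) (c' : List α → R)
    (d' : List α → S) (hF : ∀ l y, F (c' l * y) = d' l * G y) (l : List α) :
    F (selSum k c c' l) = selSum (fun s => G (k s)) d d' l := by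
  induction l generalizing k F c' d' with
  | nil => simp [selSum, hF]
  | cons a l ih =>
    rw [selSum, map_add, hF, ih _ G c d hG, ih _ F _ _ fun s => hF (a :: s), selSum]

theorem ringHom_selSum {R S : Type*} [Ring R] [Ring S] (F : R →+* S) (k c c' : List α → R)
    (l : List α) :
    F (selSum k c c' l) = selSum (fun s => F (k s)) (fun s => F (c s)) (fun s => F (c' s)) l :=
  map_selSum F.toAddMonoidHom k c (fun s => F (c s)) (by simp) F.toAddMonoidHom c' _ (by simp) l

/-- Selecting a subword of a subword is the same as selecting a subword and then a subword of each
gap. This is the combinatorial core of coassociativity. -/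
theorem selSum_selSum (q r : List α → R) (hqr : ∀ s t, Commute (q s) (r t))
    (p q' r' : List α → R) (hr : ∀ s t, Commute (q' s) (r t)) (l : List α) :
    selSum (selSum p q q') r r' l = selSum p (selSum q r r) (selSum q' r r') l := by
  induction l generalizing p q' r' with
  | nil => simp [selSum, mul_assoc]
  | cons a l ih =>
    have e1 : selSum (fun s => selSum p q q' (a :: s)) r r l
        = q' [] * selSum (fun s => p (a :: s)) (selSum q r r) (selSum q r r) l
          + selSum p (selSum q r r) (selSum (fun s => q' (a :: s)) r r) l := by
      simp only [selSum]
      rw [selSum_add_left, selSum_mul_left _ _ _ _ (hr []) (hr []),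
        ih _ q r hqr, ih _ _ r fun s => hr (a :: s)]
    have e2 : selSum p (selSum q r r) (fun s => selSum q' r r' (a :: s)) l
        = r' [] * selSum p (selSum q r r) (selSum (fun s => q' (a :: s)) r r) l
          + selSum p (selSum q r r) (selSum q' r fun s => r' (a :: s)) l := by
      simp only [selSum]
      rw [selSum_add_gap, selSum_mul_gap]
    rw [selSum, e1, selSum, e2, ih _ q' _ hr]
    simp only [selSum, mul_add, mul_assoc]
    abel

end SelSumAlgebra

/-! ### Counit laws -/

section Counit

variable {A : Type u} [AddCommGroup A] [Module ℂ A]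

theorem counit_one : counit A 1 = 1 := by simp [counit]

theorem counit_mul (x y : DT A) : counit A (x * y) = counit A x * counit A y := by simp [counit]

theorem counit_ι (w : TPlus A) : counit A (TensorAlgebra.ι ℂ w) = 0 := by
  simp [counit, TensorAlgebra.algebraMapInv]

theorem counit_listWord_cons (a : A) (l : List A) : counit A (listWord (a :: l)) = 0 := by
  obtain ⟨w, hw⟩ := listWord_mem_range_ι a l
  rw [hw, counit_ι]

variable (A) in
/-- `ε ⊗ id`. -/
noncomputable def counitLeft : DT A ⊗[ℂ] DT A →ₐ[ℂ] DT A :=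
  (Algebra.TensorProduct.lid ℂ (DT A)).toAlgHom.comp
    (Algebra.TensorProduct.map TensorAlgebra.algebraMapInv (AlgHom.id ℂ (DT A)))

variable (A) in
/-- `id ⊗ ε`. -/
noncomputable def counitRight : DT A ⊗[ℂ] DT A →ₐ[ℂ] DT A :=
  (Algebra.TensorProduct.rid ℂ ℂ (DT A)).toAlgHom.comp
    (Algebra.TensorProduct.map (AlgHom.id ℂ (DT A)) TensorAlgebra.algebraMapInv)

@[simp] theorem counitLeft_tmul (x y : DT A) : counitLeft A (x ⊗ₜ y) = counit A x • y := by
  simp [counitLeft, counit]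

@[simp] theorem counitRight_tmul (x y : DT A) : counitRight A (x ⊗ₜ y) = counit A y • x := by
  simp [counitRight, counit]

theorem counitLeft_selSum (k : List A → List A) (c' : List A → DT A ⊗[ℂ] DT A) (l : List A) :
    counitLeft A (selSum (fun s => leftLeg (k s)) rightLeg c' l)
      = selSum (fun s => counit A (listWord (k s)) • (1 : DT A)) listWord
        (fun s => counitLeft A (c' s)) l := by
  have := ringHom_selSum (counitLeft A).toRingHom (fun s => leftLeg (k s)) rightLeg c' l
  simpa [leftLeg, rightLeg, counit_one] using this

theorem counitRight_selSum (k c' : List A → DT A ⊗[ℂ] DT A) (l : List A) :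
    counitRight A (selSum k rightLeg c' l)
      = selSum (fun s => counitRight A (k s)) (fun s => counit A (listWord s) • (1 : DT A))
        (fun s => counitRight A (c' s)) l := by
  have := ringHom_selSum (counitRight A).toRingHom k rightLeg c' l
  simpa [rightLeg, counit_one] using this

/-- The defining property of `extendHalf δ`, with the first factor arbitrary. -/
theorem extendHalf_mul (δ : TPlus A →ₗ[ℂ] DT A ⊗[ℂ] DT A) (x y : DT A) :
    extendHalf δ (x * y) = extendHalf δ x * coprod A y + counit A x • extendHalf δ y := by
  induction x using DT_induction with
  | one => simp [extendHalf_one, counit_one]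
  | add x z hx hz => simp only [add_mul, map_add, hx, hz, add_smul]; abel
  | smul c x hx => simp only [smul_mul_assoc, map_smul, hx, smul_add, smul_assoc]
  | word_mul a l x _ =>
    obtain ⟨w, hw⟩ := listWord_mem_range_ι a l
    rw [hw, mul_assoc, extendHalf_ι_mul, extendHalf_ι_mul, counit_mul, counit_ι, map_mul]
    simp [mul_assoc]

theorem coprodLeft_mul (x y : DT A) :
    coprodLeft A (x * y) = coprodLeft A x * coprod A y + counit A x • coprodLeft A y :=
  extendHalf_mul _ x y

theorem coprodRight_mul (x y : DT A) :
    coprodRight A (x * y) = coprodRight A x * coprod A y + counit A x • coprodRight A y :=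
  extendHalf_mul _ x y

theorem coprodLeft_one : coprodLeft A 1 = 0 := extendHalf_one _

theorem coprodRight_one : coprodRight A 1 = 0 := extendHalf_one _

theorem coprodLeft_listWord_mul (a : A) (l : List A) (x : DT A) :
    coprodLeft A (listWord (a :: l) * x) = coprodLeft A (listWord (a :: l)) * coprod A x := by
  rw [coprodLeft_cons_mul, coprodLeft_cons]

theorem coprodRight_listWord_mul (a : A) (l : List A) (x : DT A) :
    coprodRight A (listWord (a :: l) * x) = coprodRight A (listWord (a :: l)) * coprod A x := by
  rw [coprodRight_cons_mul, coprodRight_cons]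

theorem counitLeft_coprod (x : DT A) : counitLeft A (coprod A x) = x := by
  have : (counitLeft A).comp (coprod A) = AlgHom.id ℂ _ := by
    refine algHom_ext_listWord fun a l => ?_
    simp only [AlgHom.comp_apply, coprod_listWord, AlgHom.id_apply]
    rw [counitLeft_selSum (fun s => s), selSum_indicator_left]
    · simp [rightLeg, counit_one]
    · simp [counit_one]
    · simp [counit_listWord_cons]
  exact DFunLike.congr_fun this x

theorem counitRight_coprod (x : DT A) : counitRight A (coprod A x) = x := by
  have : (counitRight A).comp (coprod A) = AlgHom.id ℂ _ := by
    refine algHom_ext_listWord fun a l => ?_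
    simp only [AlgHom.comp_apply, coprod_listWord, AlgHom.id_apply]
    rw [counitRight_selSum]
    simp only [rightLeg, counitRight_tmul]
    rw [selSum_indicator_gap]
    · simp [leftLeg, counit_one]
    · simp [counit_one]
    · simp [counit_listWord_cons]
  exact DFunLike.congr_fun this x

theorem counitLeft_coprodLeft (x : DT A) : counitLeft A (coprodLeft A x) = 0 := by
  induction x using DT_induction with
  | one => simp [coprodLeft_one]
  | add x y hx hy => simp [hx, hy]
  | smul c x hx => simp [hx]
  | word_mul a l x _ =>
    rw [coprodLeft_listWord_mul, map_mul, coprodLeft_cons, counitLeft_selSum (fun s => a :: s)]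
    simp [counit_listWord_cons, selSum_zero_left]

theorem counitRight_coprodRight (x : DT A) : counitRight A (coprodRight A x) = 0 := by
  induction x using DT_induction with
  | one => simp [coprodRight_one]
  | add x y hx hy => simp [hx, hy]
  | smul c x hx => simp [hx]
  | word_mul a l x _ =>
    rw [coprodRight_listWord_mul, map_mul, coprodRight_cons, counitRight_selSum]
    simp [rightLeg, counit_listWord_cons, selSum_zero_gap]

theorem coprodLeft_add_coprodRight (x : DT A) :
    coprodLeft A x + coprodRight A x = coprod A x - counit A x • 1 := by
  induction x using DT_induction with
  | one => simp [coprodLeft_one, coprodRight_one, counit_one]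
  | add x y hx hy =>
    simp only [map_add, add_smul, add_sub_add_comm, ← hx, ← hy]; abel
  | smul c x hx => rw [map_smul, map_smul, ← smul_add, hx]; simp [smul_sub, mul_smul]
  | word_mul a l x _ =>
    rw [coprodLeft_listWord_mul, coprodRight_listWord_mul, ← add_mul, ← coprod_listWord_cons,
      counit_mul, counit_listWord_cons]
    simp

theorem counitRight_coprodLeft (x : DT A) :
    counitRight A (coprodLeft A x) = x - counit A x • 1 := by
  have := congrArg (counitRight A) (coprodLeft_add_coprodRight x)
  simpa [counitRight_coprodRight, counitRight_coprod] using this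

theorem counitLeft_coprodRight (x : DT A) :
    counitLeft A (coprodRight A x) = x - counit A x • 1 := by
  have := congrArg (counitLeft A) (coprodLeft_add_coprodRight x)
  simpa [counitLeft_coprodLeft, counitLeft_coprod] using this

end Counit

/-! ### Coassociativity and the unshuffle relations -/

section Coassoc

variable {A : Type u} [AddCommGroup A] [Module ℂ A]

/-- `(D ⊗ id)`, with values in the right-bracketed triple tensor product. -/
noncomputable def applyLeft (D : DT A →ₗ[ℂ] DT A ⊗[ℂ] DT A) :
    DT A ⊗[ℂ] DT A →ₗ[ℂ] DT A ⊗[ℂ] (DT A ⊗[ℂ] DT A) :=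
  (TensorProduct.assoc ℂ (DT A) (DT A) (DT A)).toLinearMap.comp (D.rTensor (DT A))

/-- `(id ⊗ D)`. -/
noncomputable def applyRight (D : DT A →ₗ[ℂ] DT A ⊗[ℂ] DT A) :
    DT A ⊗[ℂ] DT A →ₗ[ℂ] DT A ⊗[ℂ] (DT A ⊗[ℂ] DT A) :=
  D.lTensor (DT A)

variable (A) in
/-- The embedding `x ⊗ y ↦ x ⊗ y ⊗ 1`. -/
noncomputable def embLeft : DT A ⊗[ℂ] DT A →ₐ[ℂ] DT A ⊗[ℂ] (DT A ⊗[ℂ] DT A) :=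
  Algebra.TensorProduct.map (AlgHom.id ℂ _) Algebra.TensorProduct.includeLeft

variable (A) in
/-- The embedding `z ↦ 1 ⊗ z`. -/
noncomputable def embRight : DT A ⊗[ℂ] DT A →ₐ[ℂ] DT A ⊗[ℂ] (DT A ⊗[ℂ] DT A) :=
  Algebra.TensorProduct.includeRight

@[simp] theorem embLeft_tmul (x y : DT A) : embLeft A (x ⊗ₜ y) = x ⊗ₜ (y ⊗ₜ 1) := by
  simp [embLeft]

@[simp] theorem embRight_apply (z : DT A ⊗[ℂ] DT A) : embRight A z = 1 ⊗ₜ z := by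
  simp [embRight]

theorem applyLeft_tmul (D : DT A →ₗ[ℂ] DT A ⊗[ℂ] DT A) (x y : DT A) :
    applyLeft D (x ⊗ₜ y) = embLeft A (D x) * (1 ⊗ₜ (1 ⊗ₜ y)) := by
  rw [applyLeft, LinearMap.comp_apply, LinearMap.rTensor_tmul]
  induction D x using TensorProduct.induction_on with
  | zero => simp
  | tmul u v => simp
  | add u v hu hv => simp only [TensorProduct.add_tmul, map_add, hu, hv, add_mul]

@[simp] theorem applyRight_tmul (D : DT A →ₗ[ℂ] DT A ⊗[ℂ] DT A) (x y : DT A) :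
    applyRight D (x ⊗ₜ y) = x ⊗ₜ D y := by simp [applyRight]

theorem embLeft_commute (z : DT A ⊗[ℂ] DT A) (x : DT A) :
    embLeft A z * (1 ⊗ₜ (1 ⊗ₜ x)) = (1 ⊗ₜ (1 ⊗ₜ x)) * embLeft A z := by
  induction z using TensorProduct.induction_on with
  | zero => simp
  | tmul u v => simp
  | add u v hu hv => simp only [map_add, hu, hv, add_mul, mul_add]

theorem applyLeft_coprod_mul (Y Z : DT A ⊗[ℂ] DT A) :
    applyLeft (coprod A).toLinearMap (Y * Z)
      = applyLeft (coprod A).toLinearMap Y * applyLeft (coprod A).toLinearMap Z := by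
  induction Y using TensorProduct.induction_on with
  | zero => simp
  | add u v hu hv => simp only [map_add, hu, hv, add_mul]
  | tmul x y =>
    induction Z using TensorProduct.induction_on with
    | zero => simp
    | add u v hu hv => simp only [map_add, hu, hv, mul_add]
    | tmul z t =>
      simp only [Algebra.TensorProduct.tmul_mul_tmul, applyLeft_tmul, AlgHom.toLinearMap_apply,
        map_mul]
      have : (1 : DT A) ⊗ₜ[ℂ] ((1 : DT A) ⊗ₜ[ℂ] (y * t))
          = (1 ⊗ₜ (1 ⊗ₜ y)) * (1 ⊗ₜ (1 ⊗ₜ t)) := by simp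
      rw [this, mul_assoc, mul_assoc, ← mul_assoc _ (1 ⊗ₜ[ℂ] (1 ⊗ₜ[ℂ] y)), embLeft_commute,
        mul_assoc]

/-- `D ⊗ id` on a product; the second term comes from the scalar part of the first leg of `Y`, and
vanishes for `Y` in the image of `Δ_≺`. -/
theorem applyLeft_mul (D : DT A →ₗ[ℂ] DT A ⊗[ℂ] DT A)
    (hD : ∀ x y, D (x * y) = D x * coprod A y + counit A x • D y) (Y Z : DT A ⊗[ℂ] DT A) :
    applyLeft D (Y * Z) = applyLeft D Y * applyLeft (coprod A).toLinearMap Z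
      + (1 ⊗ₜ (1 ⊗ₜ counitLeft A Y)) * applyLeft D Z := by
  induction Y using TensorProduct.induction_on with
  | zero => simp
  | add u v hu hv =>
    simp only [map_add, hu, hv, add_mul, TensorProduct.tmul_add]; abel
  | tmul x y =>
    induction Z using TensorProduct.induction_on with
    | zero => simp
    | add u v hu hv => simp only [map_add, hu, hv, mul_add]; abel
    | tmul z t =>
      simp only [Algebra.TensorProduct.tmul_mul_tmul, applyLeft_tmul, AlgHom.toLinearMap_apply,
        hD, map_add, map_mul, map_smul, counitLeft_tmul]
      have : (1 : DT A) ⊗ₜ[ℂ] ((1 : DT A) ⊗ₜ[ℂ] (y * t))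
          = (1 ⊗ₜ (1 ⊗ₜ y)) * (1 ⊗ₜ (1 ⊗ₜ t)) := by simp
      rw [this, add_mul]
      congr 1
      · rw [mul_assoc, mul_assoc, ← mul_assoc _ (1 ⊗ₜ[ℂ] (1 ⊗ₜ[ℂ] y)), embLeft_commute,
          mul_assoc]
      · rw [← mul_assoc, smul_mul_assoc, embLeft_commute]
        simp only [TensorProduct.tmul_smul, smul_mul_assoc, mul_assoc]

theorem applyRight_coprod_mul (Y Z : DT A ⊗[ℂ] DT A) :
    applyRight (coprod A).toLinearMap (Y * Z)
      = applyRight (coprod A).toLinearMap Y * applyRight (coprod A).toLinearMap Z := by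
  induction Y using TensorProduct.induction_on with
  | zero => simp
  | add u v hu hv => simp only [map_add, hu, hv, add_mul]
  | tmul x y =>
    induction Z using TensorProduct.induction_on with
    | zero => simp
    | add u v hu hv => simp only [map_add, hu, hv, mul_add]
    | tmul z t => simp

/-- `id ⊗ D` on a product; the second term comes from the scalar part of the second leg of `Y`, and
vanishes for `Y` in the image of `Δ_≻`. -/
theorem applyRight_mul (D : DT A →ₗ[ℂ] DT A ⊗[ℂ] DT A)
    (hD : ∀ x y, D (x * y) = D x * coprod A y + counit A x • D y) (Y Z : DT A ⊗[ℂ] DT A) :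
    applyRight D (Y * Z) = applyRight D Y * applyRight (coprod A).toLinearMap Z
      + (counitRight A Y ⊗ₜ 1) * applyRight D Z := by
  induction Y using TensorProduct.induction_on with
  | zero => simp
  | add u v hu hv =>
    simp only [map_add, hu, hv, add_mul, TensorProduct.add_tmul]; abel
  | tmul x y =>
    induction Z using TensorProduct.induction_on with
    | zero => simp
    | add u v hu hv => simp only [map_add, hu, hv, mul_add]; abel
    | tmul z t => simp [hD, TensorProduct.tmul_add, TensorProduct.smul_tmul']

/-- A word placed in the first leg of the triple tensor product. -/
noncomputable def leg₁ (s : List A) : DT A ⊗[ℂ] (DT A ⊗[ℂ] DT A) := listWord s ⊗ₜ (1 ⊗ₜ 1)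

/-- A word placed in the second leg of the triple tensor product. -/
noncomputable def leg₂ (s : List A) : DT A ⊗[ℂ] (DT A ⊗[ℂ] DT A) := 1 ⊗ₜ (listWord s ⊗ₜ 1)

/-- A word placed in the third leg of the triple tensor product. -/
noncomputable def leg₃ (s : List A) : DT A ⊗[ℂ] (DT A ⊗[ℂ] DT A) := 1 ⊗ₜ (1 ⊗ₜ listWord s)

theorem leg₂_commute_leg₃ (s t : List A) : Commute (leg₂ s) (leg₃ t) := by
  simp [Commute, SemiconjBy, leg₂, leg₃]

theorem applyLeft_selSum (D : DT A →ₗ[ℂ] DT A ⊗[ℂ] DT A) (k g : List A → List A) (l : List A) :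
    applyLeft D (selSum (fun s => leftLeg (k s)) rightLeg (fun s => rightLeg (g s)) l)
      = selSum (fun s => embLeft A (D (listWord (k s)))) leg₃ (fun s => leg₃ (g s)) l := by
  have key : ∀ (l : List A) (y : DT A ⊗[ℂ] DT A),
      applyLeft D (rightLeg l * y) = leg₃ l * applyLeft D y := by
    intro l y
    induction y using TensorProduct.induction_on with
    | zero => simp
    | add u v hu hv => simp only [map_add, hu, hv, mul_add]
    | tmul x y =>
      have : (1 : DT A) ⊗ₜ[ℂ] ((1 : DT A) ⊗ₜ[ℂ] (listWord l * y))
          = (1 ⊗ₜ (1 ⊗ₜ listWord l)) * (1 ⊗ₜ (1 ⊗ₜ y)) := by simp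
      rw [rightLeg, Algebra.TensorProduct.tmul_mul_tmul, applyLeft_tmul, applyLeft_tmul, this,
        one_mul, ← mul_assoc, embLeft_commute, mul_assoc, leg₃]
  have := map_selSum (applyLeft D).toAddMonoidHom (fun s => leftLeg (k s)) rightLeg leg₃
    key (applyLeft D).toAddMonoidHom (fun s => rightLeg (g s)) (fun s => leg₃ (g s))
    (fun l y => key (g l) y) l
  simpa [leftLeg, applyLeft_tmul, ← Algebra.TensorProduct.one_def] using this

theorem applyRight_selSum (D : DT A →ₗ[ℂ] DT A ⊗[ℂ] DT A) (k g : List A → List A)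
    (hD : ∀ s x, D (listWord (g s) * x) = D (listWord (g s)) * coprod A x) (l : List A) :
    applyRight D (selSum (fun s => leftLeg (k s)) rightLeg (fun s => rightLeg (g s)) l)
      = selSum (fun s => leg₁ (k s)) (fun s => embRight A (coprod A (listWord s)))
        (fun s => embRight A (D (listWord (g s)))) l := by
  have := map_selSum (applyRight (coprod A).toLinearMap).toAddMonoidHom
    (fun s => leftLeg (k s)) rightLeg (fun s => embRight A (coprod A (listWord s)))
    (fun l y => by
      simp [applyRight_coprod_mul, rightLeg])
    (applyRight D).toAddMonoidHom (fun s => rightLeg (g s))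
    (fun s => embRight A (D (listWord (g s)))) (fun l y => by
      induction y using TensorProduct.induction_on with
      | zero => simp
      | add u v hu hv => simp only [map_add, hu, hv, mul_add]
      | tmul x y => simp [rightLeg, hD]) l
  simpa [leftLeg, leg₁, Algebra.TensorProduct.one_def] using this

theorem embLeft_selSum (k g : List A → List A) (l : List A) :
    embLeft A (selSum (fun s => leftLeg (k s)) rightLeg (fun s => rightLeg (g s)) l)
      = selSum (fun s => leg₁ (k s)) leg₂ (fun s => leg₂ (g s)) l := by
  have := ringHom_selSum (embLeft A).toRingHom (fun s => leftLeg (k s)) rightLeg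
    (fun s => rightLeg (g s)) l
  simpa [leftLeg, rightLeg, leg₁,
    show (leg₂ : List A → _) = fun s => 1 ⊗ₜ (listWord s ⊗ₜ 1) from rfl] using this

theorem embRight_selSum (k g : List A → List A) (l : List A) :
    embRight A (selSum (fun s => leftLeg (k s)) rightLeg (fun s => rightLeg (g s)) l)
      = selSum (fun s => leg₂ (k s)) leg₃ (fun s => leg₃ (g s)) l := by
  have := ringHom_selSum (embRight A).toRingHom (fun s => leftLeg (k s)) rightLeg
    (fun s => rightLeg (g s)) l
  simpa [leftLeg, rightLeg, leg₂,
    show (leg₃ : List A → _) = fun s => 1 ⊗ₜ (1 ⊗ₜ listWord s) from rfl] using this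

/-- Coassociativity `(Δ ⊗ id) Δ = (id ⊗ Δ) Δ`. -/
theorem coassoc (x : DT A) : applyLeft (coprod A).toLinearMap (coprod A x)
    = applyRight (coprod A).toLinearMap (coprod A x) := by
  induction x using DT_induction with
  | one => simp [Algebra.TensorProduct.one_def, applyLeft_tmul]
  | add x y hx hy => simp only [map_add, hx, hy]
  | smul c x hx => simp only [map_smul, hx]
  | word_mul a l x hx =>
    rw [map_mul, applyLeft_coprod_mul, applyRight_coprod_mul, hx, coprod_listWord]
    congr 1
    rw [applyLeft_selSum _ (fun s => s) (fun s => s),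
      applyRight_selSum _ (fun s => s) (fun s => s) (by simp)]
    simp only [AlgHom.toLinearMap_apply, coprod_listWord, embLeft_selSum (fun s => s) (fun s => s),
      embRight_selSum (fun s => s) (fun s => s)]
    exact selSum_selSum _ _ leg₂_commute_leg₃ _ _ _ leg₂_commute_leg₃ _

/-- `(Δ_≺ ⊗ id) Δ_≺ = (id ⊗ Δ) Δ_≺`: the first letter belongs to the first leg. -/
theorem coassoc_left_left (x : DT A) : applyLeft (coprodLeft A) (coprodLeft A x)
    = applyRight (coprod A).toLinearMap (coprodLeft A x) := by
  induction x using DT_induction with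
  | one => simp [coprodLeft_one]
  | add x y hx hy => simp only [map_add, hx, hy]
  | smul c x hx => simp only [map_smul, hx]
  | word_mul a l x _ =>
    rw [coprodLeft_listWord_mul, applyLeft_mul _ coprodLeft_mul, applyRight_coprod_mul,
      counitLeft_coprodLeft, coassoc, coprodLeft_cons]
    simp only [TensorProduct.tmul_zero, zero_mul, add_zero]
    congr 1
    rw [applyLeft_selSum _ (fun s => a :: s) (fun s => s),
      applyRight_selSum _ (fun s => a :: s) (fun s => s) (by simp)]
    simp only [AlgHom.toLinearMap_apply, coprodLeft_cons, coprod_listWord,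
      embLeft_selSum (fun s => a :: s) (fun s => s), embRight_selSum (fun s => s) (fun s => s)]
    exact selSum_selSum _ _ leg₂_commute_leg₃ _ _ _ leg₂_commute_leg₃ _

/-- `(Δ_≻ ⊗ id) Δ_≺ = (id ⊗ Δ_≺) Δ_≻`: the first letter belongs to the second leg. -/
theorem coassoc_right_left (x : DT A) : applyLeft (coprodRight A) (coprodLeft A x)
    = applyRight (coprodLeft A) (coprodRight A x) := by
  induction x using DT_induction with
  | one => simp [coprodLeft_one, coprodRight_one]
  | add x y hx hy => simp only [map_add, hx, hy]
  | smul c x hx => simp only [map_smul, hx]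
  | word_mul a l x _ =>
    rw [coprodLeft_listWord_mul, coprodRight_listWord_mul, applyLeft_mul _ coprodRight_mul,
      applyRight_mul _ coprodLeft_mul, counitLeft_coprodLeft, counitRight_coprodRight,
      coassoc, coprodLeft_cons, coprodRight_cons]
    simp only [TensorProduct.tmul_zero, TensorProduct.zero_tmul, zero_mul, add_zero]
    congr 1
    rw [applyLeft_selSum _ (fun s => a :: s) (fun s => s),
      applyRight_selSum _ (fun s => s) (fun s => a :: s) fun s => coprodLeft_listWord_mul a s]
    simp only [coprodLeft_cons, coprodRight_cons, coprod_listWord,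
      embLeft_selSum (fun s => s) (fun s => a :: s), embRight_selSum (fun s => a :: s) (fun s => s),
      embRight_selSum (fun s => s) (fun s => s)]
    exact selSum_selSum _ _ leg₂_commute_leg₃ _ (fun s => leg₂ (a :: s)) _
      (fun s t => leg₂_commute_leg₃ _ t) _

/-- `(Δ ⊗ id) Δ_≻ = (id ⊗ Δ_≻) Δ_≻`: the first letter belongs to the third leg. -/
theorem coassoc_right_right (x : DT A) :
    applyLeft (coprod A).toLinearMap (coprodRight A x)
      = applyRight (coprodRight A) (coprodRight A x) := by
  induction x using DT_induction with
  | one => simp [coprodRight_one]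
  | add x y hx hy => simp only [map_add, hx, hy]
  | smul c x hx => simp only [map_smul, hx]
  | word_mul a l x _ =>
    rw [coprodRight_listWord_mul, applyLeft_coprod_mul, applyRight_mul _ coprodRight_mul,
      counitRight_coprodRight, coassoc, coprodRight_cons]
    simp only [TensorProduct.zero_tmul, zero_mul, add_zero]
    congr 1
    rw [applyLeft_selSum _ (fun s => s) (fun s => a :: s),
      applyRight_selSum _ (fun s => s) (fun s => a :: s) fun s => coprodRight_listWord_mul a s]
    simp only [AlgHom.toLinearMap_apply, coprodRight_cons, coprod_listWord,
      embLeft_selSum (fun s => s) (fun s => s), embRight_selSum (fun s => s) (fun s => a :: s),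
      embRight_selSum (fun s => s) (fun s => s)]
    exact selSum_selSum _ _ leg₂_commute_leg₃ _ _ _ leg₂_commute_leg₃ _

end Coassoc

/-! ### Convolution of functionals -/

section Functionals

variable {A : Type u} [AddCommGroup A] [Module ℂ A]

/-- `m ∘ (f ⊗ g)`. -/
noncomputable def pairing (f g : Functional A) : DT A ⊗[ℂ] DT A →ₗ[ℂ] ℂ :=
  (LinearMap.mul' ℂ ℂ).comp (TensorProduct.map f g)

@[simp] theorem pairing_tmul (f g : Functional A) (x y : DT A) :
    pairing f g (x ⊗ₜ y) = f x * g y := by simp [pairing]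

theorem conv_apply (f g : Functional A) (x : DT A) : conv f g x = pairing f g (coprod A x) := rfl

theorem halfLeft_apply (f g : Functional A) (x : DT A) :
    halfLeft f g x = pairing f g (coprodLeft A x) := rfl

theorem halfRight_apply (f g : Functional A) (x : DT A) :
    halfRight f g x = pairing f g (coprodRight A x) := rfl

theorem pairing_counit_left (f : Functional A) (z : DT A ⊗[ℂ] DT A) :
    pairing (counit A) f z = f (counitLeft A z) := by
  induction z using TensorProduct.induction_on with
  | zero => simp
  | tmul x y => simp
  | add x y hx hy => simp only [map_add, hx, hy]

theorem pairing_counit_right (f : Functional A) (z : DT A ⊗[ℂ] DT A) :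
    pairing f (counit A) z = f (counitRight A z) := by
  induction z using TensorProduct.induction_on with
  | zero => simp
  | tmul x y => simp [mul_comm]
  | add x y hx hy => simp only [map_add, hx, hy]

theorem pairing_comp_left (D : DT A →ₗ[ℂ] DT A ⊗[ℂ] DT A) (f g h : Functional A)
    (z : DT A ⊗[ℂ] DT A) : pairing ((pairing f g).comp D) h z
      = ((LinearMap.mul' ℂ ℂ).comp (TensorProduct.map f (pairing g h))) (applyLeft D z) := by
  induction z using TensorProduct.induction_on with
  | zero => simp
  | add x y hx hy => simp only [map_add, hx, hy]
  | tmul x y =>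
    rw [applyLeft_tmul, pairing_tmul, LinearMap.comp_apply]
    induction D x using TensorProduct.induction_on with
    | zero => simp
    | tmul u v => simp [mul_assoc]
    | add u v hu hv => simp only [map_add, hu, hv, add_mul]

theorem pairing_comp_right (D : DT A →ₗ[ℂ] DT A ⊗[ℂ] DT A) (f g h : Functional A)
    (z : DT A ⊗[ℂ] DT A) : pairing f ((pairing g h).comp D) z
      = ((LinearMap.mul' ℂ ℂ).comp (TensorProduct.map f (pairing g h))) (applyRight D z) := by
  induction z using TensorProduct.induction_on with
  | zero => simp
  | add x y hx hy => simp only [map_add, hx, hy]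
  | tmul x y => simp

theorem conv_assoc (f g h : Functional A) : conv (conv f g) h = conv f (conv g h) := by
  ext1 x
  exact (pairing_comp_left (coprod A).toLinearMap f g h _).trans
    ((congrArg _ (coassoc x)).trans (pairing_comp_right (coprod A).toLinearMap f g h _).symm)

theorem halfLeft_halfLeft (f g h : Functional A) :
    halfLeft (halfLeft f g) h = halfLeft f (conv g h) := by
  ext1 x
  exact (pairing_comp_left (coprodLeft A) f g h _).trans
    ((congrArg _ (coassoc_left_left x)).trans
      (pairing_comp_right (coprod A).toLinearMap f g h _).symm)

theorem halfLeft_halfRight (f g h : Functional A) :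
    halfLeft (halfRight f g) h = halfRight f (halfLeft g h) := by
  ext1 x
  exact (pairing_comp_left (coprodRight A) f g h _).trans
    ((congrArg _ (coassoc_right_left x)).trans
      (pairing_comp_right (coprodLeft A) f g h _).symm)

theorem halfRight_halfRight (f g h : Functional A) :
    halfRight f (halfRight g h) = halfRight (conv f g) h := by
  ext1 x
  exact ((pairing_comp_left (coprod A).toLinearMap f g h _).trans
    ((congrArg _ (coassoc_right_right x)).trans
      (pairing_comp_right (coprodRight A) f g h _).symm)).symm

theorem counit_conv (f : Functional A) : conv (counit A) f = f := by
  ext1 x; rw [conv_apply, pairing_counit_left, counitLeft_coprod]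

theorem conv_counit (f : Functional A) : conv f (counit A) = f := by
  ext1 x; rw [conv_apply, pairing_counit_right, counitRight_coprod]

theorem counit_halfRight (f : Functional A) (hf : f 1 = 0) : halfRight (counit A) f = f := by
  ext1 x; rw [halfRight_apply, pairing_counit_left, counitLeft_coprodRight]; simp [hf]

theorem halfLeft_counit (f : Functional A) (hf : f 1 = 0) : halfLeft f (counit A) = f := by
  ext1 x; rw [halfLeft_apply, pairing_counit_right, counitRight_coprodLeft]; simp [hf]

theorem pairing_add_left (f g h : Functional A) :
    pairing (f + g) h = pairing f h + pairing g h := by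
  simp [pairing, TensorProduct.map_add_left, LinearMap.comp_add]

theorem pairing_add_right (f g h : Functional A) :
    pairing f (g + h) = pairing f g + pairing f h := by
  simp [pairing, TensorProduct.map_add_right, LinearMap.comp_add]

theorem pairing_smul_left (c : ℂ) (f g : Functional A) :
    pairing (c • f) g = c • pairing f g := by
  simp [pairing, TensorProduct.map_smul_left, LinearMap.comp_smul]

theorem pairing_smul_right (c : ℂ) (f g : Functional A) :
    pairing f (c • g) = c • pairing f g := by
  simp [pairing, TensorProduct.map_smul_right, LinearMap.comp_smul]

/-- `m ∘ (f ⊗ g) ∘ D`, bilinear in `f` and `g`. -/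
noncomputable def product (D : DT A →ₗ[ℂ] DT A ⊗[ℂ] DT A) :
    Functional A →ₗ[ℂ] Functional A →ₗ[ℂ] Functional A :=
  LinearMap.mk₂ ℂ (fun f g => (pairing f g).comp D)
    (fun f g h => by rw [pairing_add_left, LinearMap.add_comp])
    (fun c f g => by rw [pairing_smul_left, LinearMap.smul_comp])
    (fun f g h => by rw [pairing_add_right, LinearMap.add_comp])
    (fun c f g => by rw [pairing_smul_right, LinearMap.smul_comp])

theorem product_apply (D : DT A →ₗ[ℂ] DT A ⊗[ℂ] DT A) (f g : Functional A) (x : DT A) :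
    product D f g x = pairing f g (D x) := rfl

theorem conv_eq_product (f g : Functional A) :
    conv f g = product (coprod A).toLinearMap f g := rfl

theorem halfLeft_eq_product (f g : Functional A) : halfLeft f g = product (coprodLeft A) f g := rfl

theorem halfRight_eq_product (f g : Functional A) :
    halfRight f g = product (coprodRight A) f g := rfl

end Functionals

/-! ### The degree filtration and pointwise eventually constant sequences -/

section Filtration

variable {A : Type u} [AddCommGroup A] [Module ℂ A]

/-- The tensors of total degree at most `n`. -/
noncomputable def degreeLE (A : Type u) [AddCommGroup A] [Module ℂ A] (n : ℕ) :
    Submodule ℂ (DT A ⊗[ℂ] DT A) :=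
  Submodule.span ℂ {z | ∃ L L' : List (List A),
    L.flatten.length + L'.flatten.length ≤ n ∧ z = barWord L ⊗ₜ barWord L'}

theorem one_mem_degreeLE : (1 : DT A ⊗[ℂ] DT A) ∈ degreeLE A 0 :=
  Submodule.subset_span ⟨[], [], by simp, by simp [Algebra.TensorProduct.one_def]⟩

theorem mul_mem_degreeLE {m n : ℕ} {x y : DT A ⊗[ℂ] DT A} (hx : x ∈ degreeLE A m)
    (hy : y ∈ degreeLE A n) : x * y ∈ degreeLE A (m + n) := by
  have h := Submodule.mul_mem_mul hx hy
  rw [degreeLE, degreeLE, Submodule.span_mul_span] at h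
  refine Submodule.span_mono ?_ h
  rintro _ ⟨_, ⟨L₁, L₂, hL, rfl⟩, _, ⟨M₁, M₂, hM, rfl⟩, rfl⟩
  refine ⟨L₁ ++ M₁, L₂ ++ M₂, ?_, by simp [barWord_append]⟩
  simp only [List.flatten_append, List.length_append]
  omega

theorem length_positions {n : ℕ} (S : Finset (Fin n)) : (positions S).length = S.card := by
  rw [← List.toFinset_card_of_nodup (nodup_positions S)]
  congr 1
  ext i
  simp [mem_positions]

theorem coprodOn_mem_degreeLE (P : (n : ℕ) → Finset (Finset (Fin (n + 1)))) {n : ℕ}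
    (m : Fin (n + 1) → A) :
    coprodOn A P (DirectSum.lof ℂ ℕ (fun n : ℕ => ⨂[ℂ]^(n + 1) A) n (PiTensorProduct.tprod ℂ m))
      ∈ degreeLE A (n + 1) := by
  rw [coprodOn_lof_tprod]
  refine Submodule.sum_mem _ fun S _ => Submodule.subset_span
    ⟨[(positions S).map m], (gaps S).map (List.map m), ?_, by simp⟩
  rw [← List.map_flatten, flatten_gaps]
  simp [length_positions]

/-- `D` does not raise the degree. -/
def IsFiltered (D : DT A →ₗ[ℂ] DT A ⊗[ℂ] DT A) : Prop :=
  ∀ L : List (List A), D (barWord L) ∈ degreeLE A L.flatten.length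

theorem isFiltered_coprod : IsFiltered (coprod A).toLinearMap := by
  intro L
  induction L with
  | nil => simp [one_mem_degreeLE]
  | cons l L ih =>
    cases l with
    | nil => simpa using ih
    | cons a l =>
      obtain ⟨n, m, h⟩ := exists_ofFn_eq_cons a l
      have hn : (a :: l).length = n + 1 := by rw [← h]; simp
      rw [barWord_cons, AlgHom.toLinearMap_apply, map_mul, List.flatten_cons, List.length_append,
        hn]
      refine mul_mem_degreeLE ?_ ih
      rw [← h, ← ι_lof_tprod, coprod, TensorAlgebra.lift_ι_apply]
      exact coprodOn_mem_degreeLE _ m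

theorem isFiltered_extendHalf (P : (n : ℕ) → Finset (Finset (Fin (n + 1)))) :
    IsFiltered (extendHalf (coprodOn A P)) := by
  intro L
  induction L with
  | nil => simp [extendHalf_one]
  | cons l L ih =>
    cases l with
    | nil => simpa using ih
    | cons a l =>
      obtain ⟨n, m, h⟩ := exists_ofFn_eq_cons a l
      have hn : (a :: l).length = n + 1 := by rw [← h]; simp
      rw [barWord_cons, List.flatten_cons, List.length_append, hn, ← h, ← ι_lof_tprod,
        extendHalf_ι_mul]
      exact mul_mem_degreeLE (coprodOn_mem_degreeLE _ m) (isFiltered_coprod L)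

theorem isFiltered_coprodLeft : IsFiltered (coprodLeft A) := isFiltered_extendHalf _

theorem isFiltered_coprodRight : IsFiltered (coprodRight A) := isFiltered_extendHalf _

/-- The functionals that vanish in degrees below `n`. -/
noncomputable def vanishBelow (A : Type u) [AddCommGroup A] [Module ℂ A] (n : ℕ) :
    Submodule ℂ (Functional A) where
  carrier := {f | ∀ L : List (List A), L.flatten.length < n → f (barWord L) = 0}
  add_mem' hf hg L hL := by simp [hf L hL, hg L hL]
  zero_mem' L _ := by simp
  smul_mem' c f hf L hL := by simp [hf L hL]

theorem vanishBelow_anti {m n : ℕ} (h : m ≤ n) : vanishBelow A n ≤ vanishBelow A m :=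
  fun _ hf L hL => hf L (hL.trans_le h)

theorem mem_vanishBelow_zero (f : Functional A) : f ∈ vanishBelow A 0 := fun L hL => by simp at hL

theorem mem_vanishBelow_one {f : Functional A} (hf : f 1 = 0) : f ∈ vanishBelow A 1 := by
  intro L hL
  have : barWord L = 1 := by
    induction L with
    | nil => simp
    | cons l L ih =>
      cases l with
      | nil => simpa using ih (by simpa using hL)
      | cons a l => simp at hL
  rw [this, hf]

theorem product_mem_vanishBelow {D : DT A →ₗ[ℂ] DT A ⊗[ℂ] DT A} (hD : IsFiltered D) {i j : ℕ}
    {f g : Functional A} (hf : f ∈ vanishBelow A i) (hg : g ∈ vanishBelow A j) :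
    product D f g ∈ vanishBelow A (i + j) := by
  intro L hL
  rw [product_apply]
  have h := hD L
  refine Submodule.span_induction (p := fun z _ => pairing f g z = 0) ?_ (by simp) ?_ ?_ h
  · rintro _ ⟨M, M', hM, rfl⟩
    rw [pairing_tmul]
    rcases lt_or_ge M.flatten.length i with h1 | h1
    · rw [hf M h1, zero_mul]
    · rw [hg M' (by omega), mul_zero]
  · intro x y _ _ hx hy; rw [map_add, hx, hy, add_zero]
  · intro c x _ hx; rw [map_smul, hx, smul_zero]

theorem exists_degree_bound (x : DT A) :
    ∃ N : ℕ, ∀ n, N ≤ n → ∀ f ∈ vanishBelow A n, f x = 0 := by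
  have hx : x ∈ Submodule.span ℂ (Set.range (barWord : List (List A) → DT A)) := by
    rw [span_barWord]; trivial
  induction hx using Submodule.span_induction with
  | mem x hx =>
    obtain ⟨L, rfl⟩ := hx
    exact ⟨L.flatten.length + 1, fun n hn f hf => hf L hn⟩
  | zero => exact ⟨0, by simp⟩
  | add x y _ _ hx hy =>
    obtain ⟨N, hN⟩ := hx
    obtain ⟨M, hM⟩ := hy
    refine ⟨max N M, fun n hn f hf => ?_⟩
    rw [map_add, hN n (le_of_max_le_left hn) f hf, hM n (le_of_max_le_right hn) f hf, add_zero]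
  | smul c x _ hx =>
    obtain ⟨N, hN⟩ := hx
    exact ⟨N, fun n hn f hf => by rw [map_smul, hN n hn f hf, smul_zero]⟩

theorem eq_zero_of_forall_mem_vanishBelow {f : Functional A} (h : ∀ n, f ∈ vanishBelow A n) :
    f = 0 := by
  ext1 x
  obtain ⟨N, hN⟩ := exists_degree_bound x
  exact hN N le_rfl f (h N)

theorem locallyFinite_of_mem_vanishBelow {F : ℕ → Functional A}
    (h : ∀ n, F n ∈ vanishBelow A n) : LocallyFinite F := by
  intro x
  obtain ⟨N, hN⟩ := exists_degree_bound x
  refine (Set.finite_lt_nat N).subset fun n hn => ?_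
  by_contra hlt
  exact hn (hN n (not_lt.1 hlt) _ (h n))

/-- Convergence of functionals: at each argument the sequence is eventually constant, with value
that of the limit. -/
def ConvergesTo (s : ℕ → Functional A) (t : Functional A) : Prop :=
  ∀ x, ∀ᶠ N in Filter.atTop, s N x = t x

theorem ConvergesTo.unique {s : ℕ → Functional A} {t t' : Functional A} (h : ConvergesTo s t)
    (h' : ConvergesTo s t') : t = t' := by
  ext1 x
  obtain ⟨N, h1, h2⟩ := ((h x).and (h' x)).exists
  rw [← h1, h2]

theorem ConvergesTo.const (t : Functional A) : ConvergesTo (fun _ => t) t :=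
  fun _ => Filter.Eventually.of_forall fun _ => rfl

theorem ConvergesTo.succ {s : ℕ → Functional A} {t : Functional A} (h : ConvergesTo s t) :
    ConvergesTo (fun N => s (N + 1)) t :=
  fun x => (Filter.tendsto_add_atTop_nat 1).eventually (h x)

theorem ConvergesTo.add {s s' : ℕ → Functional A} {t t' : Functional A} (h : ConvergesTo s t)
    (h' : ConvergesTo s' t') : ConvergesTo (fun N => s N + s' N) (t + t') := by
  intro x
  filter_upwards [h x, h' x] with N h1 h2
  simp [h1, h2]

theorem ConvergesTo.product {s s' : ℕ → Functional A} {t t' : Functional A}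
    (h : ConvergesTo s t) (h' : ConvergesTo s' t') (D : DT A →ₗ[ℂ] DT A ⊗[ℂ] DT A) :
    ConvergesTo (fun N => product D (s N) (s' N)) (product D t t') := by
  intro x
  simp only [product_apply]
  induction D x using TensorProduct.induction_on with
  | zero => simp
  | tmul y z =>
    filter_upwards [h y, h' z] with N h1 h2
    simp [h1, h2]
  | add y z hy hz =>
    filter_upwards [hy, hz] with N h1 h2
    rw [map_add, map_add, h1, h2]

theorem convergesTo_zero {s : ℕ → Functional A} (h : ∀ n, s n ∈ vanishBelow A n) :
    ConvergesTo s 0 := by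
  intro x
  obtain ⟨N, hN⟩ := exists_degree_bound x
  filter_upwards [Filter.eventually_ge_atTop N] with n hn
  exact hN n hn _ (h n)

theorem convergesTo_locSum {F : ℕ → Functional A} (h : LocallyFinite F) :
    ConvergesTo (fun N => ∑ k ∈ Finset.range N, F k) (locSum F) := by
  intro x
  obtain ⟨N, hN⟩ := (h x).bddAbove
  filter_upwards [Filter.eventually_gt_atTop N] with M hM
  rw [locSum, dif_pos h]
  change _ = ∑ᶠ n, F n x
  rw [finsum_eq_sum_of_support_subset (s := Finset.range M)]
  · simp
  · intro n hn
    have := hN hn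
    simp only [Finset.coe_range, Set.mem_Iio]
    omega

theorem convPow_mem_vanishBelow {α : Functional A} (hα : α 1 = 0) (n : ℕ) :
    convPow α n ∈ vanishBelow A n := by
  induction n with
  | zero => exact mem_vanishBelow_zero _
  | succ n ih =>
    rw [convPow, conv_eq_product, add_comm]
    exact product_mem_vanishBelow isFiltered_coprod (mem_vanishBelow_one hα) ih

theorem rightPow_mem_vanishBelow {α : Functional A} (hα : α 1 = 0) (n : ℕ) :
    rightPow α n ∈ vanishBelow A n := by
  induction n with
  | zero => exact mem_vanishBelow_zero _
  | succ n ih =>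
    rw [rightPow, halfRight_eq_product]
    exact product_mem_vanishBelow isFiltered_coprodRight ih (mem_vanishBelow_one hα)

/-- `ℰ_≻(α)` solves the fixed point equation `E = ε + E ≻ α`. -/
theorem rightExp_eq {α : Functional A} (hα : α 1 = 0) :
    rightExp α = counit A + halfRight (rightExp α) α := by
  have h := convergesTo_locSum (locallyFinite_of_mem_vanishBelow (rightPow_mem_vanishBelow hα))
  have e : (fun N => ∑ k ∈ Finset.range (N + 1), rightPow α k) = fun N => counit A
      + product (coprodRight A) (∑ k ∈ Finset.range N, rightPow α k) α := funext fun N => by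
    rw [Finset.sum_range_succ', map_sum, LinearMap.sum_apply, add_comm]
    rfl
  refine h.succ.unique ?_
  rw [e]
  exact (ConvergesTo.const _).add (h.product (ConvergesTo.const α) _)

/-- A solution of `f = f ≻ α` vanishes in all degrees below `n`, by induction on `n`. -/
theorem eq_zero_of_eq_halfRight {α f : Functional A} (hα : α 1 = 0) (hf : f = halfRight f α) :
    f = 0 := by
  refine eq_zero_of_forall_mem_vanishBelow fun n => ?_
  induction n with
  | zero => exact mem_vanishBelow_zero _
  | succ n ih =>
    rw [hf, halfRight_eq_product]
    exact product_mem_vanishBelow isFiltered_coprodRight ih (mem_vanishBelow_one hα)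

theorem eq_rightExp {α f : Functional A} (hα : α 1 = 0) (hf : f = counit A + halfRight f α) :
    f = rightExp α := by
  refine sub_eq_zero.1 (eq_zero_of_eq_halfRight hα ?_)
  conv_lhs => rw [hf, rightExp_eq hα]
  simp [halfRight_eq_product]

end Filtration

/-! ### Characters and infinitesimal characters -/

section Characters

variable {A : Type u} [AddCommGroup A] [Module ℂ A]

/-- The character with the same values as `f` on `T₊(A)`. -/
noncomputable def charOf (f : Functional A) : DT A →ₐ[ℂ] ℂ :=
  TensorAlgebra.lift ℂ (f.comp (TensorAlgebra.ι ℂ))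

theorem charOf_ι (f : Functional A) (w : TPlus A) :
    charOf f (TensorAlgebra.ι ℂ w) = f (TensorAlgebra.ι ℂ w) := by
  simp [charOf]

theorem isCharacter_algHom (F : DT A →ₐ[ℂ] ℂ) : IsCharacter F.toLinearMap :=
  ⟨by simp, by simp⟩

theorem isCharacter_counit : IsCharacter (counit A) := isCharacter_algHom _

theorem IsCharacter.eq_of_ι {f g : Functional A} (hf : IsCharacter f) (hg : IsCharacter g)
    (h : ∀ w, f (TensorAlgebra.ι ℂ w) = g (TensorAlgebra.ι ℂ w)) : f = g := by
  ext1 x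
  induction x using DT_induction with
  | one => rw [hf.1, hg.1]
  | add x y hx hy => rw [map_add, map_add, hx, hy]
  | smul c x hx => rw [map_smul, map_smul, hx]
  | word_mul a l x hx =>
    obtain ⟨w, hw⟩ := listWord_mem_range_ι a l
    rw [hw, hf.2, hg.2, hx, h]

theorem pairing_mul {f g : Functional A} (hf : IsCharacter f) (hg : IsCharacter g)
    (Y Z : DT A ⊗[ℂ] DT A) : pairing f g (Y * Z) = pairing f g Y * pairing f g Z := by
  induction Y using TensorProduct.induction_on with
  | zero => simp
  | add u v hu hv => simp only [map_add, hu, hv, add_mul]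
  | tmul x y =>
    induction Z using TensorProduct.induction_on with
    | zero => simp
    | add u v hu hv => simp only [map_add, hu, hv, mul_add]
    | tmul z t =>
      simp only [Algebra.TensorProduct.tmul_mul_tmul, pairing_tmul, hf.2, hg.2]; ring

theorem isCharacter_conv {f g : Functional A} (hf : IsCharacter f) (hg : IsCharacter g) :
    IsCharacter (conv f g) :=
  ⟨by simp [conv_apply, Algebra.TensorProduct.one_def, hf.1, hg.1],
    fun x y => by simp only [conv_apply, map_mul, pairing_mul hf hg]⟩

/-- The left leg of the coproduct of a word is a single word, so that only the values of `f` on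
single words matter. -/
theorem pairing_coprodOn_congr {f f' : Functional A} (h1 : f 1 = f' 1)
    (h : ∀ w, f (TensorAlgebra.ι ℂ w) = f' (TensorAlgebra.ι ℂ w)) (g : Functional A)
    (P : (n : ℕ) → Finset (Finset (Fin (n + 1)))) (w : TPlus A) :
    pairing f g (coprodOn A P w) = pairing f' g (coprodOn A P w) := by
  induction w using TPlus_induction with
  | zero => simp
  | add x y hx hy => simp only [map_add, hx, hy]
  | smul c x hx => simp only [map_smul, hx]
  | tprod n m =>
    rw [coprodOn_lof_tprod, map_sum, map_sum]
    refine Finset.sum_congr rfl fun S _ => ?_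
    rw [pairing_tmul, pairing_tmul]
    congr 1
    cases (positions S).map m with
    | nil => simpa using h1
    | cons a l =>
      obtain ⟨w, hw⟩ := listWord_mem_range_ι a l
      rw [hw, h]

theorem conv_ι_congr {f f' : Functional A} (h1 : f 1 = f' 1)
    (h : ∀ w, f (TensorAlgebra.ι ℂ w) = f' (TensorAlgebra.ι ℂ w)) (g : Functional A)
    (w : TPlus A) :
    conv f g (TensorAlgebra.ι ℂ w) = conv f' g (TensorAlgebra.ι ℂ w) := by
  rw [conv_apply, conv_apply, coprod, TensorAlgebra.lift_ι_apply,
    pairing_coprodOn_congr h1 h]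

theorem halfRight_ι_congr {f f' : Functional A} (h1 : f 1 = f' 1)
    (h : ∀ w, f (TensorAlgebra.ι ℂ w) = f' (TensorAlgebra.ι ℂ w)) (g : Functional A)
    (w : TPlus A) :
    halfRight f g (TensorAlgebra.ι ℂ w) = halfRight f' g (TensorAlgebra.ι ℂ w) := by
  have hw := fun δ => extendHalf_ι_mul (A := A) δ w 1
  simp only [mul_one, map_one] at hw
  rw [halfRight_apply, halfRight_apply, coprodRight, hw, pairing_coprodOn_congr h1 h]

/-- Infinitesimal characters are the `(ε, ε)`-derivations. -/
theorem IsInfinitesimal.mul {α : Functional A} (hα : IsInfinitesimal α) (x y : DT A) :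
    α (x * y) = α x * counit A y + counit A x * α y := by
  have key : ∀ (y : DT A) (l : List (TPlus A)), l ≠ [] →
      α ((l.map (TensorAlgebra.ι ℂ)).prod * y)
        = α ((l.map (TensorAlgebra.ι ℂ)).prod) * counit A y := by
    intro y
    induction y using DT_induction with
    | one => simp [counit_one]
    | add x y hx hy => intro l hl; simp only [mul_add, map_add, hx l hl, hy l hl]
    | smul c x hx =>
      intro l hl
      simp only [mul_smul_comm, map_smul, hx l hl, smul_eq_mul]; ring
    | word_mul a m y hy =>
      intro l hl
      obtain ⟨w, hw⟩ := listWord_mem_range_ι a m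
      have h := hy (l ++ [w]) (by simp)
      rw [hα.2 (l ++ [w])] at h
      · rw [counit_mul, hw, counit_ι, ← mul_assoc]
        simpa using h
      · cases l with
        | nil => exact absurd rfl hl
        | cons b l => simp
  induction x using DT_induction with
  | one => simp [hα.1, counit_one]
  | add x z hx hz => simp only [add_mul, map_add, hx, hz]; ring
  | smul c x hx => simp only [smul_mul_assoc, map_smul, hx, smul_eq_mul]; ring
  | word_mul a l x _ =>
    obtain ⟨w, hw⟩ := listWord_mem_range_ι a l
    have h1 := key (x * y) [w] (by simp)
    have h2 := key x [w] (by simp)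
    simp only [List.map_cons, List.map_nil, List.prod_singleton] at h1 h2
    rw [hw, mul_assoc, h1, h2, counit_mul, counit_mul, counit_ι]
    ring

theorem isInfinitesimal_of_ι_mul {α : Functional A} (h1 : α 1 = 0)
    (h : ∀ w x, α (TensorAlgebra.ι ℂ w * x) = α (TensorAlgebra.ι ℂ w) * counit A x) :
    IsInfinitesimal α := by
  refine ⟨h1, fun l hl => ?_⟩
  match l, hl with
  | w :: w' :: l, _ => simp [h, counit_mul, counit_ι]

theorem pairing_mul_infinitesimal {f α : Functional A} (hf : IsCharacter f)
    (hα : IsInfinitesimal α) (Y Z : DT A ⊗[ℂ] DT A) :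
    pairing f α (Y * Z) = pairing f α Y * pairing f (counit A) Z
      + pairing f (counit A) Y * pairing f α Z := by
  induction Y using TensorProduct.induction_on with
  | zero => simp
  | add u v hu hv => simp only [map_add, hu, hv, add_mul]; ring
  | tmul x y =>
    induction Z using TensorProduct.induction_on with
    | zero => simp
    | add u v hu hv => simp only [map_add, hu, hv, mul_add]; ring
    | tmul z t =>
      simp only [Algebra.TensorProduct.tmul_mul_tmul, pairing_tmul, hf.2, hα.mul]; ring

theorem halfRight_one (f g : Functional A) : halfRight f g 1 = 0 := by
  rw [halfRight_apply, coprodRight_one, map_zero]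

theorem halfLeft_one (f g : Functional A) : halfLeft f g 1 = 0 := by
  rw [halfLeft_apply, coprodLeft_one, map_zero]

/-- For a character `f` and an infinitesimal character `α`, the functional `f ≻ α` is an
`(ε, f)`-derivation. -/
theorem halfRight_mul {f α : Functional A} (hf : IsCharacter f) (hα : IsInfinitesimal α)
    (x y : DT A) :
    halfRight f α (x * y) = halfRight f α x * f y + counit A x * halfRight f α y := by
  simp only [halfRight_apply, coprodRight_mul, map_add, map_smul,
    pairing_mul_infinitesimal hf hα, pairing_counit_right, counitRight_coprodRight,
    counitRight_coprod, map_zero, zero_mul, add_zero, smul_eq_mul]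

/-- The character with the values of `ℰ_≻(α)` on `T₊(A)` solves the same fixed point equation. -/
theorem isCharacter_rightExp {α : Functional A} (hα : IsInfinitesimal α) :
    IsCharacter (rightExp α) := by
  have hE := rightExp_eq hα.1
  have hE1 : rightExp α 1 = 1 := by
    rw [hE, LinearMap.add_apply, counit_one, halfRight_one, add_zero]
  have hG : (charOf (rightExp α)).toLinearMap = rightExp α := by
    refine eq_rightExp hα.1 (LinearMap.ext fun x => ?_)
    rw [LinearMap.add_apply]
    induction x using DT_induction with
    | one => simp [counit_one, halfRight_one]
    | add x y hx hy => simp only [map_add, hx, hy]; ring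
    | smul c x hx => simp only [map_smul, hx, smul_eq_mul]; ring
    | word_mul a l x _ =>
      obtain ⟨w, hw⟩ := listWord_mem_range_ι a l
      rw [hw, halfRight_mul (isCharacter_algHom _) hα, counit_mul, counit_ι,
        halfRight_ι_congr (f' := rightExp α) (by simp [hE1]) (by simp [charOf_ι])]
      have := LinearMap.congr_fun hE (TensorAlgebra.ι ℂ w)
      rw [LinearMap.add_apply, counit_ι, zero_add] at this
      simp [charOf_ι, ← this]
  rw [← hG]
  exact isCharacter_algHom _

theorem convPow_succ' (α : Functional A) (n : ℕ) :
    convPow α (n + 1) = conv (convPow α n) α := by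
  induction n with
  | zero => simp [convPow, conv_counit, counit_conv]
  | succ n ih =>
    change conv α (convPow α (n + 1)) = conv (conv α (convPow α n)) α
    rw [ih, conv_assoc]

/-- The convolution inverse is the Neumann series of `ε - f`. -/
theorem exists_isConvInv {f : Functional A} (hf : f 1 = 1) : ∃ g, IsConvInv f g := by
  have hδ : (counit A - f) 1 = 0 := by simp [counit_one, hf]
  have h := convergesTo_locSum (locallyFinite_of_mem_vanishBelow (convPow_mem_vanishBelow hδ))
  have hf' : f = counit A - (counit A - f) := by simp
  generalize counit A - f = δ at *
  refine ⟨locSum (convPow δ), ?_, ?_⟩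
  · have e : (fun N => ∑ k ∈ Finset.range (N + 1), convPow δ k) = fun N => counit A
        + product (coprod A).toLinearMap δ (∑ k ∈ Finset.range N, convPow δ k) :=
      funext fun N => by
        rw [Finset.sum_range_succ', map_sum, add_comm]
        rfl
    have h1 : locSum (convPow δ) = counit A + conv δ (locSum (convPow δ)) := by
      refine h.succ.unique ?_
      rw [e]
      exact (ConvergesTo.const _).add ((ConvergesTo.const δ).product h _)
    rw [hf', conv_eq_product, map_sub, LinearMap.sub_apply, ← conv_eq_product,
      ← conv_eq_product, counit_conv, sub_eq_iff_eq_add]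
    exact h1
  · have e : (fun N => ∑ k ∈ Finset.range (N + 1), convPow δ k) = fun N => counit A
        + product (coprod A).toLinearMap (∑ k ∈ Finset.range N, convPow δ k) δ :=
      funext fun N => by
        rw [Finset.sum_range_succ', map_sum, LinearMap.sum_apply, add_comm]
        simp only [convPow_succ']
        rfl
    have h1 : locSum (convPow δ) = counit A + conv (locSum (convPow δ)) δ := by
      refine h.succ.unique ?_
      rw [e]
      exact (ConvergesTo.const _).add (h.product (ConvergesTo.const δ) _)
    rw [hf', conv_eq_product, map_sub, ← conv_eq_product, ← conv_eq_product,
      conv_counit, sub_eq_iff_eq_add]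
    exact h1

theorem isConvInv_convInv {f : Functional A} (hf : f 1 = 1) : IsConvInv f (convInv f) :=
  Classical.epsilon_spec (exists_isConvInv hf)

theorem conv_one (f g : Functional A) : conv f g 1 = f 1 * g 1 := by
  simp [conv_apply, Algebra.TensorProduct.one_def]

/-- The character with the values of `g` on `T₊(A)` is a left inverse of `f` as well. -/
theorem IsCharacter.of_isConvInv {f g : Functional A} (hf : IsCharacter f)
    (h : IsConvInv f g) : IsCharacter g := by
  have hg1 : g 1 = 1 := by
    have := LinearMap.congr_fun h.2 1
    rwa [conv_one, hf.1, mul_one, counit_one] at this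
  have hG : conv (charOf g).toLinearMap f = counit A := by
    refine (isCharacter_conv (isCharacter_algHom _) hf).eq_of_ι isCharacter_counit fun w => ?_
    rw [conv_ι_congr (f' := g) (by simp [hg1]) (by simp [charOf_ι]), h.2]
  have : g = (charOf g).toLinearMap := by
    rw [← conv_counit (charOf g).toLinearMap, ← h.1, ← conv_assoc, hG, counit_conv]
  rw [this]
  exact isCharacter_algHom _

/-- The derivation property of `f^{*-1} ≻ α` leaves the factor `f^{*-1} * f = ε` behind. -/
theorem isInfinitesimal_adjoint {f α : Functional A} (hf : IsCharacter f)
    (hα : IsInfinitesimal α) : IsInfinitesimal (adjoint f α) := by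
  have hinv := isConvInv_convInv hf.1
  have hg := hf.of_isConvInv hinv
  have hmul : ∀ Y Z : DT A ⊗[ℂ] DT A, pairing (halfRight (convInv f) α) f (Y * Z)
      = pairing (halfRight (convInv f) α) f Y * pairing (convInv f) f Z
        + pairing (counit A) f Y * pairing (halfRight (convInv f) α) f Z := by
    intro Y Z
    induction Y using TensorProduct.induction_on with
    | zero => simp
    | add u v hu hv => simp only [map_add, hu, hv, add_mul]; ring
    | tmul x y =>
      induction Z using TensorProduct.induction_on with
      | zero => simp
      | add u v hu hv => simp only [map_add, hu, hv, mul_add]; ring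
      | tmul z t =>
        simp only [Algebra.TensorProduct.tmul_mul_tmul, pairing_tmul, hf.2, halfRight_mul hg hα]
        ring
  refine isInfinitesimal_of_ι_mul (halfLeft_one _ _) fun w x => ?_
  rw [adjoint, halfLeft_apply, coprodLeft_mul, counit_ι, zero_smul, add_zero, hmul,
    pairing_counit_left, counitLeft_coprodLeft, map_zero, zero_mul, add_zero, ← conv_apply,
    hinv.2, halfLeft_apply]

/-- `θ_f(α)` is determined by `f ≻ θ_f(α) = α ≺ f`. -/
theorem eq_adjoint_iff {f α κ : Functional A} (hf : f 1 = 1) (hκ : κ 1 = 0) :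
    κ = adjoint f α ↔ halfRight f κ = halfLeft α f := by
  have hinv := isConvInv_convInv hf
  have hθ : adjoint f α = halfRight (convInv f) (halfLeft α f) := halfLeft_halfRight _ _ _
  constructor
  · intro h
    rw [h, hθ, halfRight_halfRight, hinv.1, counit_halfRight _ (halfLeft_one _ _)]
  · intro h
    rw [hθ, ← h, halfRight_halfRight, hinv.2, counit_halfRight _ hκ]

end Characters

/-! ### The pre-Lie exponential -/

section PreLie

variable {A : Type u} [AddCommGroup A] [Module ℂ A]

theorem preLie_iterate_mem_vanishBelow {α γ : Functional A} (hα : α 1 = 0) (hγ : γ 1 = 0)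
    (n : ℕ) : (fun α' : Functional A => preLie α' γ)^[n] α ∈ vanishBelow A (n + 1) := by
  induction n with
  | zero => exact mem_vanishBelow_one hα
  | succ n ih =>
    rw [Function.iterate_succ_apply', preLie, halfLeft_eq_product, halfRight_eq_product]
    refine sub_mem (product_mem_vanishBelow isFiltered_coprodLeft ih (mem_vanishBelow_one hγ)) ?_
    rw [add_comm]
    exact product_mem_vanishBelow isFiltered_coprodRight (mem_vanishBelow_one hγ) ih

theorem preLieExpTerm_mem_vanishBelow {α γ : Functional A} (hα : α 1 = 0) (hγ : γ 1 = 0)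
    (n : ℕ) : preLieExpTerm γ α n ∈ vanishBelow A n :=
  Submodule.smul_mem _ _
    (vanishBelow_anti (Nat.le_succ n) (preLie_iterate_mem_vanishBelow hα hγ n))

/-- Right multiplication `α ↦ α ≺ γ`. -/
noncomputable def mulHalfLeft (γ : Functional A) : Module.End ℂ (Functional A) :=
  (product (coprodLeft A)).flip γ

/-- Left multiplication `α ↦ γ ≻ α`. -/
noncomputable def mulHalfRight (γ : Functional A) : Module.End ℂ (Functional A) :=
  product (coprodRight A) γ

theorem commute_mulHalf (γ : Functional A) : Commute (mulHalfRight γ) (mulHalfLeft γ) := by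
  ext1 α
  exact (halfLeft_halfRight γ α γ).symm

theorem mulHalfRight_pow (γ α : Functional A) (hα : α 1 = 0) (n : ℕ) :
    (mulHalfRight γ ^ n) α = halfRight (convPow γ n) α := by
  induction n with
  | zero => exact (counit_halfRight α hα).symm
  | succ n ih =>
    rw [pow_succ', Module.End.mul_apply, ih, convPow, ← halfRight_halfRight]
    rfl

theorem mulHalfLeft_pow (γ α : Functional A) (hα : α 1 = 0) (n : ℕ) :
    (mulHalfLeft γ ^ n) α = halfLeft α (convPow γ n) := by
  induction n with
  | zero => exact (halfLeft_counit α hα).symm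
  | succ n ih =>
    rw [pow_succ', Module.End.mul_apply, ih, convPow_succ', ← halfLeft_halfLeft]
    rfl

theorem preLie_iterate (γ α : Functional A) (n : ℕ) :
    (fun α' : Functional A => preLie α' γ)^[n] α = ((mulHalfLeft γ - mulHalfRight γ) ^ n) α := by
  rw [Module.End.pow_apply]
  rfl

/-- Square partial sums may be replaced by triangular ones, as the difference has high degree. -/
theorem convergesTo_sum_antidiagonal {G : ℕ → ℕ → Functional A}
    (hG : ∀ k l, G k l ∈ vanishBelow A (k + l)) {t : Functional A}
    (h : ConvergesTo (fun N => ∑ k ∈ Finset.range N, ∑ l ∈ Finset.range N, G k l) t) :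
    ConvergesTo (fun N => ∑ n ∈ Finset.range N,
      ∑ p ∈ Finset.HasAntidiagonal.antidiagonal n, G p.1 p.2) t := by
  have h0 : ConvergesTo (fun N => (∑ n ∈ Finset.range N,
      ∑ p ∈ Finset.HasAntidiagonal.antidiagonal n, G p.1 p.2)
      - ∑ k ∈ Finset.range N, ∑ l ∈ Finset.range N, G k l) 0 := by
    refine convergesTo_zero fun N => ?_
    have hsub : ∑ n ∈ Finset.range N, ∑ p ∈ Finset.HasAntidiagonal.antidiagonal n, G p.1 p.2
        = ∑ p ∈ (Finset.range N ×ˢ Finset.range N).filter (fun p => p.1 + p.2 < N),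
            G p.1 p.2 := by
      rw [Finset.sum_sigma']
      refine Finset.sum_nbij' (fun p => p.2) (fun p => ⟨p.1 + p.2, p⟩) ?_ ?_ ?_ ?_ ?_
      · rintro ⟨n, k, l⟩ h
        simp at h ⊢
        omega
      · rintro ⟨k, l⟩ h
        simp at h ⊢
        omega
      · rintro ⟨n, k, l⟩ h
        simp at h ⊢
        exact h.2
      · rintro ⟨k, l⟩ _; rfl
      · rintro ⟨n, k, l⟩ _; rfl
    rw [hsub, ← Finset.sum_product', ← Finset.sum_filter_add_sum_filter_not
      (Finset.range N ×ˢ Finset.range N) (fun p => p.1 + p.2 < N), sub_add_cancel_left]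
    refine neg_mem (Submodule.sum_mem _ fun p hp => vanishBelow_anti ?_ (hG p.1 p.2))
    simpa using (Finset.mem_filter.1 hp).2
  simpa using h0.add h

/-- Conjugation by `exp^*(γ)` is the exponential of the right pre-Lie multiplication by `γ`: since
`α ↦ γ ≻ α` and `α ↦ α ≺ γ` commute, `exp^*(γ) ≻ e^{r_{⊲γ}}(α) = α ≺ exp^*(γ)`. -/
theorem preLieExp_eq_adjoint {α γ : Functional A} (hα : α 1 = 0) (hγ : γ 1 = 0)
    (hexp : convExp γ 1 = 1) : preLieExp γ α = adjoint (convExp γ) α := by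
  have hF := preLieExpTerm_mem_vanishBelow hα hγ
  have hE : ∀ n, ((n.factorial : ℂ)⁻¹) • convPow γ n ∈ vanishBelow A n :=
    fun n => Submodule.smul_mem _ _ (convPow_mem_vanishBelow hγ n)
  have cF := convergesTo_locSum (locallyFinite_of_mem_vanishBelow hF)
  have cE := convergesTo_locSum (locallyFinite_of_mem_vanishBelow hE)
  have hF1 : ∀ n, preLieExpTerm γ α n 1 = 0 := fun n => by
    have h := preLie_iterate_mem_vanishBelow hα hγ n [] (by simp)
    rw [barWord_nil] at h
    rw [preLieExpTerm, LinearMap.smul_apply, h, smul_zero]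
  have hP1 : preLieExp γ α 1 = 0 := by
    obtain ⟨N, hN⟩ := (cF 1).exists
    rw [preLieExp, ← hN]
    simp [hF1]
  rw [eq_adjoint_iff hexp hP1]
  have c1 := cE.product cF (coprodRight A)
  simp only [map_sum, LinearMap.sum_apply] at c1
  rw [show (fun N => ∑ l ∈ Finset.range N, ∑ k ∈ Finset.range N,
      product (coprodRight A) (((k.factorial : ℂ)⁻¹) • convPow γ k) (preLieExpTerm γ α l))
      = fun N => ∑ k ∈ Finset.range N, ∑ l ∈ Finset.range N,
      product (coprodRight A) (((k.factorial : ℂ)⁻¹) • convPow γ k) (preLieExpTerm γ α l) from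
      funext fun N => Finset.sum_comm] at c1
  have c2 := convergesTo_sum_antidiagonal
    (fun k l => product_mem_vanishBelow isFiltered_coprodRight (hE k) (hF l)) c1
  have c3 := (ConvergesTo.const α).product cE (coprodLeft A)
  refine c2.unique (t' := product (coprodLeft A) α (locSum fun n : ℕ =>
    ((n.factorial : ℂ)⁻¹) • convPow γ n)) ?_
  convert c3 using 2 with N
  rw [map_sum]
  refine Finset.sum_congr rfl fun n _ => ?_
  -- the binomial theorem for `(L + r) ^ n = R ^ n`, where `r = R - L`
  have hcomm : Commute (mulHalfRight γ) (mulHalfLeft γ - mulHalfRight γ) :=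
    (commute_mulHalf γ).sub_right (Commute.refl _)
  have hpow := LinearMap.congr_fun (hcomm.add_pow' n) α
  rw [add_sub_cancel, mulHalfLeft_pow _ _ hα, LinearMap.sum_apply] at hpow
  rw [map_smul, ← halfLeft_eq_product, hpow, Finset.smul_sum]
  refine Finset.sum_congr rfl fun p hp => ?_
  have hp' := Finset.HasAntidiagonal.mem_antidiagonal.1 hp
  rw [LinearMap.smul_apply, Module.End.mul_apply, ← preLie_iterate, mulHalfRight_pow]
  · rw [preLieExpTerm, map_smul, LinearMap.map_smul₂, ← halfRight_eq_product, smul_smul,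
      ← Nat.cast_smul_eq_nsmul ℂ, smul_smul]
    congr 1
    rw [← hp', Nat.choose_symm_add, Nat.add_choose,
      Nat.cast_div (Nat.factorial_mul_factorial_dvd_factorial_add _ _)]
    · have h1 := Nat.cast_ne_zero (R := ℂ).2 (Nat.factorial_ne_zero p.1)
      have h2 := Nat.cast_ne_zero (R := ℂ).2 (Nat.factorial_ne_zero p.2)
      have h3 := Nat.cast_ne_zero (R := ℂ).2 (Nat.factorial_ne_zero (p.1 + p.2))
      push_cast
      field_simp
    · exact_mod_cast mul_ne_zero (Nat.factorial_ne_zero _) (Nat.factorial_ne_zero _)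
  · have h := preLie_iterate_mem_vanishBelow hα hγ p.2 [] (by simp)
    rwa [barWord_nil] at h

end PreLie

/-! ### Sums over the prefixes of a word -/

section PrefixSum

variable {α β : Type*}

/-- The sum of `g p * f r` over all factorizations `p ++ r` of a word. -/
def prefixSum : (g f : List α → ℂ) → List α → ℂ
  | g, f, [] => g [] * f []
  | g, f, a :: l => g [] * f (a :: l) + prefixSum (fun s => g (a :: s)) f l

/-- The sum of `g p * f r` over the factorizations `p ++ r` of a word with `r` nonempty. -/
def properPrefixSum : (g f : List α → ℂ) → List α → ℂ
  | _, _, [] => 0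
  | g, f, a :: l => g [] * f (a :: l) + properPrefixSum (fun s => g (a :: s)) f l

theorem prefixSum_append (g f : List α → ℂ) (p r : List α) :
    prefixSum g f (p ++ r)
      = properPrefixSum g (fun s => f (s ++ r)) p + prefixSum (fun s => g (p ++ s)) f r := by
  induction p generalizing g with
  | nil => simp [properPrefixSum]
  | cons a p ih => simp [prefixSum, properPrefixSum, ih, add_assoc]

theorem prefixSum_eq (g f : List α → ℂ) (p : List α) :
    prefixSum g f p = properPrefixSum g f p + g p * f [] := by
  simpa [prefixSum] using prefixSum_append g f p []

theorem properPrefixSum_congr {g f f' : List α → ℂ} {p : List α}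
    (h : ∀ p₁ p₂, p = p₁ ++ p₂ → p₂ ≠ [] → g p₁ * f p₂ = g p₁ * f' p₂) :
    properPrefixSum g f p = properPrefixSum g f' p := by
  induction p generalizing g with
  | nil => rfl
  | cons a p ih =>
    rw [properPrefixSum, properPrefixSum, h [] (a :: p) rfl (by simp),
      ih fun p₁ p₂ e hp => h (a :: p₁) p₂ (by simp [e]) hp]

theorem properPrefixSum_zero_right (g : List α → ℂ) (p : List α) :
    properPrefixSum g (fun _ => 0) p = 0 := by
  induction p generalizing g with
  | nil => rfl
  | cons a p ih => simp [properPrefixSum, ih]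

theorem properPrefixSum_eq_zero {g f : List α → ℂ} {p : List α}
    (h : ∀ p₁ p₂, p = p₁ ++ p₂ → p₂ ≠ [] → g p₁ * f p₂ = 0) : properPrefixSum g f p = 0 := by
  rw [properPrefixSum_congr (f' := fun _ => 0) (by simpa using h), properPrefixSum_zero_right]

theorem properPrefixSum_linear (c d : ℂ) (g f f' : List α → ℂ) (p : List α) :
    properPrefixSum g (fun s => c * (f s - f' s * d)) p
      = c * (properPrefixSum g f p - properPrefixSum g f' p * d) := by
  induction p generalizing g with
  | nil => simp [properPrefixSum]
  | cons a p ih => simp only [properPrefixSum, ih]; ring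

theorem prefixSum_mul_left (c : ℂ) (g f : List α → ℂ) (l : List α) :
    prefixSum (fun s => c * g s) f l = c * prefixSum g f l := by
  induction l generalizing g with
  | nil => simp only [prefixSum]; ring
  | cons a l ih => simp only [prefixSum, ih]; ring

theorem prefixSum_zero_left (f : List α → ℂ) (l : List α) : prefixSum (fun _ => 0) f l = 0 := by
  simpa using prefixSum_mul_left 0 (fun _ => 0) f l

theorem prefixSum_congr {g g' f f' : List α → ℂ} {l : List α}
    (h : ∀ p r, l = p ++ r → g p = g' p ∧ f r = f' r) : prefixSum g f l = prefixSum g' f' l := by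
  induction l generalizing g g' with
  | nil => obtain ⟨h1, h2⟩ := h [] [] rfl; simp [prefixSum, h1, h2]
  | cons a l ih =>
    obtain ⟨h1, h2⟩ := h [] (a :: l) rfl
    rw [prefixSum, prefixSum, h1, h2, ih fun p r e => h (a :: p) r (by simp [e])]

theorem prefixSum_map (t : β → α) (g f : List α → ℂ) (l : List β) :
    prefixSum g f (l.map t) = prefixSum (fun s => g (s.map t)) (fun s => f (s.map t)) l := by
  induction l generalizing g with
  | nil => rfl
  | cons a l ih => simp [prefixSum, ih]

theorem selSum_map {R : Type*} [Ring R] (t : β → α) (k c c' : List α → R) (l : List β) :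
    selSum k c c' (l.map t)
      = selSum (fun s => k (s.map t)) (fun s => c (s.map t)) (fun s => c' (s.map t)) l := by
  induction l generalizing k c' with
  | nil => rfl
  | cons a l ih => simp [selSum, ih]

/-- If all gaps but the initial one have to be empty, the initial gap is a prefix and the selected
subword is the rest. -/
theorem selSum_indicator_inner_gap (k d c' : List α → ℂ) (h1 : d [] = 1)
    (h0 : ∀ a l, d (a :: l) = 0) (l : List α) : selSum k d c' l = prefixSum c' k l := by
  induction l generalizing c' with
  | nil => rfl
  | cons a l ih => rw [selSum, prefixSum, ih, selSum_indicator_gap _ _ h1 h0]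

end PrefixSum

/-! ### Half-products on words -/

section WordValues

variable {A : Type u} [AddCommGroup A] [Module ℂ A]

/-- An infinitesimal `α` admits a single gap, which contains the first letter and hence is a prefix.
-/
theorem halfRight_listWord_cons (f : Functional A) {α : Functional A} (hα : IsInfinitesimal α)
    (a : A) (l : List A) :
    halfRight f α (listWord (a :: l))
      = prefixSum (fun s => α (listWord (a :: s))) (fun s => f (listWord s)) l := by
  have := map_selSum (pairing f (counit A)).toAddMonoidHom leftLeg rightLeg
    (fun s => counit A (listWord s)) (fun l y => by
      induction y using TensorProduct.induction_on with
      | zero => simp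
      | add u v hu hv => simp only [map_add, hu, hv, mul_add]
      | tmul x y =>
        simp only [rightLeg, Algebra.TensorProduct.tmul_mul_tmul, LinearMap.toAddMonoidHom_coe,
          pairing_tmul, counit_mul, one_mul]
        ring)
    (pairing f α).toAddMonoidHom (fun s => rightLeg (a :: s)) (fun s => α (listWord (a :: s)))
    (fun l y => by
      induction y using TensorProduct.induction_on with
      | zero => simp
      | add u v hu hv => simp only [map_add, hu, hv, mul_add]
      | tmul x y =>
        simp only [rightLeg, Algebra.TensorProduct.tmul_mul_tmul, LinearMap.toAddMonoidHom_coe,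
          pairing_tmul, hα.mul, counit_listWord_cons, one_mul]
        ring) l
  rw [halfRight_apply, coprodRight_cons]
  refine this.trans ?_
  rw [selSum_indicator_inner_gap]
  · simp [leftLeg, counit_one]
  · simp [counit_one]
  · simp [counit_listWord_cons]

theorem halfLeft_listWord_cons (α : Functional A) {f : Functional A} (hf : IsCharacter f)
    (a : A) (l : List A) :
    halfLeft α f (listWord (a :: l))
      = selSum (fun s => α (listWord (a :: s))) (fun s => f (listWord s))
        (fun s => f (listWord s)) l := by
  have key : ∀ (l : List A) (y : DT A ⊗[ℂ] DT A),
      (pairing α f).toAddMonoidHom (rightLeg l * y)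
        = f (listWord l) * (pairing α f).toAddMonoidHom y := fun l y => by
    induction y using TensorProduct.induction_on with
    | zero => simp
    | add u v hu hv => simp only [map_add, hu, hv, mul_add]
    | tmul x y =>
      simp only [rightLeg, Algebra.TensorProduct.tmul_mul_tmul, LinearMap.toAddMonoidHom_coe,
        pairing_tmul, hf.2, one_mul]
      ring
  have := map_selSum (pairing α f).toAddMonoidHom (fun s => leftLeg (a :: s)) rightLeg
    (fun s => f (listWord s)) key (pairing α f).toAddMonoidHom rightLeg
    (fun s => f (listWord s)) key l
  rw [halfLeft_apply, coprodLeft_cons]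
  refine this.trans ?_
  simp [leftLeg, hf.1]

theorem rightExp_listWord_cons {α : Functional A} (hα : IsInfinitesimal α) (a : A) (l : List A) :
    rightExp α (listWord (a :: l))
      = prefixSum (fun s => α (listWord (a :: s))) (fun s => rightExp α (listWord s)) l := by
  conv_lhs => rw [rightExp_eq hα.1]
  rw [LinearMap.add_apply, counit_listWord_cons, zero_add, halfRight_listWord_cons _ hα]

end WordValues

end DoubleTensor

namespace OrthogonalIndependence

open DoubleTensor

/-! ### Orthogonal words in two letters -/

section TwoLetters

/-- The values on words in two letters, `true` for the first variable and `false` for the second,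
of a functional for which the second variable is orthogonal to the first; `μ` and `ν` are the
moments of the two variables. -/
structure IsOrthogonalOnWords (μ ν : ℕ → ℂ) (m : List Bool → ℂ) : Prop where
  replicate_true : ∀ n, m (List.replicate n true) = μ n
  false_cons : ∀ l, m (false :: l) = 0
  append_false : ∀ l, m (l ++ [false]) = 0
  insert_false : ∀ u v k, m (u ++ true :: (List.replicate (k + 1) false ++ true :: v))
    = ν (k + 1) * (m (u ++ true :: true :: v) - m (u ++ [true]) * m (true :: v))

theorem eq_replicate_false_or (l : List Bool) :
    (∃ n, l = List.replicate n false) ∨ ∃ k u, l = u ++ true :: List.replicate k false := by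
  induction l with
  | nil => exact Or.inl ⟨0, rfl⟩
  | cons a l ih =>
    rcases ih with ⟨n, rfl⟩ | ⟨k, u, rfl⟩
    · cases a
      · exact Or.inl ⟨n + 1, by simp [List.replicate_succ]⟩
      · exact Or.inr ⟨n, [], rfl⟩
    · exact Or.inr ⟨k, a :: u, rfl⟩

theorem eq_replicate_false_or_append (l : List Bool) : (∃ n, l = List.replicate n false) ∨
    ∃ n v, l = List.replicate n false ++ true :: v := by
  induction l with
  | nil => exact Or.inl ⟨0, rfl⟩
  | cons a l ih =>
    cases a
    · rcases ih with ⟨n, rfl⟩ | ⟨n, v, rfl⟩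
      · exact Or.inl ⟨n + 1, by simp [List.replicate_succ]⟩
      · exact Or.inr ⟨n + 1, v, by simp [List.replicate_succ]⟩
    · exact Or.inr ⟨0, l, rfl⟩

theorem word_cases (l : List Bool) : (∃ n, l = List.replicate n true) ∨ (∃ l', l = false :: l') ∨
    (∃ l', l = l' ++ [false]) ∨
    ∃ u v k, l = u ++ true :: (List.replicate (k + 1) false ++ true :: v) := by
  induction l with
  | nil => exact Or.inl ⟨0, rfl⟩
  | cons a l ih =>
    cases a
    · exact Or.inr (Or.inl ⟨l, rfl⟩)
    rcases ih with ⟨n, rfl⟩ | ⟨l', rfl⟩ | ⟨l', rfl⟩ | ⟨u, v, k, rfl⟩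
    · exact Or.inl ⟨n + 1, by simp [List.replicate_succ]⟩
    · rcases eq_replicate_false_or_append l' with ⟨n, rfl⟩ | ⟨n, v, rfl⟩
      · refine Or.inr (Or.inr (Or.inl ⟨true :: List.replicate n false, ?_⟩))
        rw [List.cons_append, ← List.replicate_succ', List.replicate_succ]
      · exact Or.inr (Or.inr (Or.inr ⟨[], v, n, by simp [List.replicate_succ]⟩))
    · exact Or.inr (Or.inr (Or.inl ⟨true :: l', rfl⟩))
    · exact Or.inr (Or.inr (Or.inr ⟨true :: u, v, k, rfl⟩))

/-- The relations compute each value from values at shorter words. -/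
theorem IsOrthogonalOnWords.unique {μ ν : ℕ → ℂ} {m m' : List Bool → ℂ}
    (h : IsOrthogonalOnWords μ ν m) (h' : IsOrthogonalOnWords μ ν m') (l : List Bool) :
    m l = m' l := by
  induction hn : l.length using Nat.strong_induction_on generalizing l with
  | _ n ih =>
    subst hn
    rcases word_cases l with ⟨n, rfl⟩ | ⟨l', rfl⟩ | ⟨l', rfl⟩ | ⟨u, v, k, rfl⟩
    · rw [h.replicate_true, h'.replicate_true]
    · rw [h.false_cons, h'.false_cons]
    · rw [h.append_false, h'.append_false]
    · rw [h.insert_false, h'.insert_false, ih _ _ (u ++ true :: true :: v) rfl,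
        ih _ _ (u ++ [true]) rfl, ih _ _ (true :: v) rfl]
      all_goals simp +arith

/-- Relations between the values, on words in two letters, of functionals on `T(T₊(A))`: `f` and `g`
are supported on the powers of the first and of the second letter, where they have the moments `μ`
and `ν`, and `f = ε + f ≻ b`, `E = ε + E ≻ t`, `g ≻ t = b ≺ g`. The values of the half-products
`≻` with an infinitesimal character, and of `≺` with a character, are sums over prefixes and over
subwords. The relations `f_nil`, `g_nil` and `E_nil` make the empty word a unit. -/
structure ConjugationData (μ ν : ℕ → ℂ) (f g b t E : List Bool → ℂ) : Prop where
  f_true : ∀ n, f (List.replicate n true) = μ n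
  f_of_mem : ∀ l, false ∈ l → f l = 0
  g_false : ∀ n, g (List.replicate n false) = ν n
  g_of_mem : ∀ l, true ∈ l → g l = 0
  f_nil : f [] = 1
  g_nil : g [] = 1
  E_nil : E [] = 1
  f_cons : ∀ a l, f (a :: l) = prefixSum (fun s => b (a :: s)) f l
  E_cons : ∀ a l, E (a :: l) = prefixSum (fun s => t (a :: s)) E l
  conj : ∀ a l, prefixSum (fun s => t (a :: s)) g l = selSum (fun s => b (a :: s)) g g l

section Selection

variable {k c c' : List Bool → ℂ}

theorem selSum_replicate_false_append (hk : ∀ l, false ∈ l → k l = 0) (n : ℕ) (l : List Bool) :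
    selSum k c c' (List.replicate n false ++ l)
      = selSum k c (fun s => c' (List.replicate n false ++ s)) l := by
  induction n generalizing c' with
  | zero => simp
  | succ n ih =>
    have h0 : (fun s => k (false :: s)) = fun _ => 0 := funext fun s => hk _ (by simp)
    rw [List.replicate_succ, List.cons_append, selSum, h0, selSum_zero_left, mul_zero, zero_add,
      ih]
    rfl

theorem selSum_true_cons (hc' : ∀ l, true ∈ l → c' l = 0) (l : List Bool) :
    selSum k c c' (true :: l) = c' [] * selSum (fun s => k (true :: s)) c c l := by
  have h0 : (fun s => c' (true :: s)) = fun _ => 0 := funext fun s => hc' _ (by simp)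
  rw [selSum, h0, selSum_zero_gap, add_zero]

theorem selSum_replicate_false_true (hk : ∀ l, false ∈ l → k l = 0)
    (hc : ∀ l, true ∈ l → c l = 0) (n : ℕ) (l : List Bool) :
    selSum k c c (List.replicate n false ++ true :: l)
      = c (List.replicate n false) * selSum (fun s => k (true :: s)) c c l := by
  rw [selSum_replicate_false_append hk, selSum_true_cons fun l hl => hc _ (by simp [hl])]
  simp

theorem selSum_replicate_true (hc1 : c [] = 1) (hc : ∀ l, true ∈ l → c l = 0) (n : ℕ) :
    selSum k c c (List.replicate n true) = k (List.replicate n true) := by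
  induction n generalizing k with
  | zero => simp [selSum, hc1]
  | succ n ih => rw [List.replicate_succ, selSum_true_cons hc, hc1, one_mul, ih]

/-- When only powers of `true` may be selected and only powers of `false` may be skipped, an
inserted block of `false` is a full gap. -/
theorem selSum_insert_false (hc1 : c [] = 1) (hk : ∀ l, false ∈ l → k l = 0)
    (hc : ∀ l, true ∈ l → c l = 0) (hc' : ∀ l, true ∈ l → c' l = 0) (n : ℕ) (u v : List Bool) :
    selSum k c c' (u ++ true :: (List.replicate n false ++ true :: v))
      = c (List.replicate n false) * selSum k c c' (u ++ true :: true :: v) := by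
  induction u generalizing k c' with
  | nil =>
    rw [List.nil_append, List.nil_append, selSum_true_cons hc', selSum_true_cons hc',
      selSum_replicate_false_true (fun l hl => hk _ (by simp [hl])) hc, selSum_true_cons hc, hc1]
    ring
  | cons a u ih =>
    rw [List.cons_append, selSum, ih (fun l hl => hk _ (by simp [hl])) hc,
      ih hk fun l hl => hc' _ (by simp [hl]), List.cons_append, selSum]
    ring

theorem selSum_append_false (hc1 : c [] = 1) (hk : ∀ l, false ∈ l → k l = 0)
    (hc : ∀ l, true ∈ l → c l = 0) (hc' : ∀ l, true ∈ l → c' l = 0) (n : ℕ) (u : List Bool) :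
    selSum k c c' (u ++ true :: List.replicate n false)
      = c (List.replicate n false) * selSum k c c' (u ++ [true]) := by
  induction u generalizing k c' with
  | nil =>
    have h := selSum_replicate_false_append (k := fun s => k (true :: s)) (c := c) (c' := c)
      (fun l hl => hk _ (by simp [hl])) n []
    rw [List.append_nil] at h
    rw [List.nil_append, List.nil_append, selSum_true_cons hc', selSum_true_cons hc', h]
    simp only [selSum, List.append_nil, hc1]
    ring
  | cons a u ih =>
    rw [List.cons_append, selSum, ih (fun l hl => hk _ (by simp [hl])) hc,
      ih hk fun l hl => hc' _ (by simp [hl]), List.cons_append, selSum]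
    ring

end Selection

end TwoLetters

/-! ### The conjugated functional on words in two letters -/

namespace ConjugationData

variable {μ ν : ℕ → ℂ} {f g b t E : List Bool → ℂ}

theorem prefixSum_eq_last {G F : List Bool → ℂ} {l : List Bool}
    (h0 : ∀ p r, l = p ++ r → r ≠ [] → G p * F r = 0) (h1 : F [] = 1) :
    prefixSum G F l = G l := by
  rw [prefixSum_eq, properPrefixSum_eq_zero h0, h1, zero_add, mul_one]

/-- In `f(w) = ∑ b(p) f(r)`, the word `w` being factored as `p r`, a letter `false` lies in `p` or
in `r`, and only the term with `r` empty is not yet known to vanish. -/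
theorem b_of_mem (h : ConjugationData μ ν f g b t E) (l : List Bool) (hl : false ∈ l) :
    b l = 0 := by
  induction hn : l.length using Nat.strong_induction_on generalizing l with
  | _ n ih =>
    subst hn
    match l with
    | [] => simp at hl
    | a :: l =>
      rw [← h.f_of_mem _ hl, h.f_cons, prefixSum_eq_last _ h.f_nil]
      rintro p r rfl hr
      have hr' := List.length_pos_of_ne_nil hr
      by_cases hp : false ∈ a :: p
      · rw [ih _ (by simp; omega) (a :: p) hp rfl, zero_mul]
      · rw [h.f_of_mem r, mul_zero]
        simp only [List.mem_cons, List.mem_append] at hl hp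
        tauto

/-- The values of `b ≺ g` on words. -/
def leftProduct (b g : List Bool → ℂ) : List Bool → ℂ
  | [] => 0
  | a :: l => selSum (fun s => b (a :: s)) g g l

theorem leftProduct_insert_false (h : ConjugationData μ ν f g b t E) (u v : List Bool) (n : ℕ) :
    leftProduct b g (u ++ true :: (List.replicate n false ++ true :: v))
      = ν n * leftProduct b g (u ++ true :: true :: v) := by
  rw [← h.g_false]
  cases u with
  | nil =>
    simp only [leftProduct, List.nil_append]
    rw [selSum_replicate_false_true (fun l hl => h.b_of_mem _ (by simp [hl])) h.g_of_mem,
      selSum_true_cons h.g_of_mem, h.g_nil, one_mul]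
  | cons a u =>
    exact selSum_insert_false h.g_nil (fun l hl => h.b_of_mem _ (by simp [hl])) h.g_of_mem
      h.g_of_mem n u v

theorem leftProduct_append_false (h : ConjugationData μ ν f g b t E) (u : List Bool) (n : ℕ) :
    leftProduct b g (u ++ true :: List.replicate n false)
      = ν n * leftProduct b g (u ++ [true]) := by
  rw [← h.g_false]
  cases u with
  | nil =>
    have := selSum_replicate_false_append (k := fun s => b (true :: s)) (c := g) (c' := g)
      (fun l hl => h.b_of_mem _ (by simp [hl])) n []
    rw [List.append_nil] at this
    simp only [leftProduct, List.nil_append]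
    rw [this]
    simp [selSum, h.g_nil]
  | cons a u =>
    exact selSum_append_false h.g_nil (fun l hl => h.b_of_mem _ (by simp [hl])) h.g_of_mem
      h.g_of_mem n u

theorem leftProduct_false_cons (h : ConjugationData μ ν f g b t E) (l : List Bool) :
    leftProduct b g (false :: l) = 0 := by
  have h0 : (fun s => b (false :: s)) = fun _ => 0 := funext fun s => h.b_of_mem _ (by simp)
  rw [leftProduct, h0, selSum_zero_left]

theorem t_false_cons (h : ConjugationData μ ν f g b t E) (l : List Bool) :
    t (false :: l) = 0 := by
  induction hn : l.length using Nat.strong_induction_on generalizing l with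
  | _ n ih =>
    subst hn
    have hc : prefixSum (fun s => t (false :: s)) g l = 0 :=
      (h.conj false l).trans (h.leftProduct_false_cons l)
    rwa [prefixSum_eq_last _ h.g_nil] at hc
    rintro p r rfl hr
    have hr' := List.length_pos_of_ne_nil hr
    rw [ih _ (by simp; omega) p rfl, zero_mul]

/-- At a word that ends with `true`, the term with empty `r` is the only one in `(b ≺ g)(w) = ∑ t(p)
g(r)`, as `g` vanishes on the others. -/
theorem t_append_true (h : ConjugationData μ ν f g b t E) (u : List Bool) :
    t (u ++ [true]) = leftProduct b g (u ++ [true]) := by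
  obtain ⟨a, l, hl⟩ : ∃ a l, u ++ [true] = a :: l := by
    cases u with
    | nil => exact ⟨_, _, rfl⟩
    | cons a u => exact ⟨_, _, rfl⟩
  rw [hl, leftProduct, ← h.conj, prefixSum_eq_last _ h.g_nil]
  rintro p r rfl hr
  rw [h.g_of_mem r, mul_zero]
  obtain ⟨r', x, rfl⟩ := (List.eq_nil_or_concat r).resolve_left hr
  have h2 : u ++ [true] = (a :: (p ++ r')) ++ [x] := by simpa using hl
  have := (List.append_inj' h2 rfl).2
  simp only [List.cons.injEq, and_true] at this
  simp [← this]

/-- For a word `w = u true false^k`, the prefix `u true` contributes `ν k * t (u true)` to `(b ≺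
g)(w) = ∑ t(p) g(r)`, which is the left-hand side already. -/
theorem t_append_false (h : ConjugationData μ ν f g b t E) (u : List Bool) :
    t (u ++ [false]) = 0 := by
  have key : ∀ (k : ℕ) (u : List Bool), t (u ++ true :: List.replicate (k + 1) false) = 0 := by
    intro k
    induction k using Nat.strong_induction_on with
    | _ k ih =>
      intro u
      obtain ⟨a, p, hp⟩ : ∃ a p, u ++ [true] = a :: p := by
        cases u with
        | nil => exact ⟨_, _, rfl⟩
        | cons a u => exact ⟨_, _, rfl⟩
      have hap : ∀ s, a :: (p ++ s) = u ++ true :: s := fun s => by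
        rw [← List.cons_append, ← hp]; simp
      have hc := h.conj a (p ++ List.replicate (k + 1) false)
      have hq := h.leftProduct_append_false u (k + 1)
      rw [← hap, leftProduct, ← h.t_append_true] at hq
      -- the only nonzero proper term is the one in which the prefix is `u ++ [true]`
      have hz : properPrefixSum (fun s => t (a :: s))
          (fun s => g (s ++ List.replicate (k + 1) false)) p = 0 := by
        refine properPrefixSum_eq_zero ?_
        rintro p₁ r rfl hr
        rw [h.g_of_mem, mul_zero]
        obtain ⟨r', x, rfl⟩ := (List.eq_nil_or_concat r).resolve_left hr
        have h2 : u ++ [true] = (a :: (p₁ ++ r')) ++ [x] := by simpa using hp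
        have := (List.append_inj' h2 rfl).2
        simp only [List.cons.injEq, and_true] at this
        simp [← this]
      rw [hq, prefixSum_append, hz, zero_add, List.replicate_succ, prefixSum,
        ← List.replicate_succ, h.g_false, prefixSum_eq_last _ h.g_nil] at hc
      · simp only [hap, List.append_nil, ← List.replicate_succ] at hc
        rw [hp] at hc
        linear_combination hc
      · intro p₁ r e hr
        have hr' := List.length_pos_of_ne_nil hr
        have hlen := congrArg List.length e
        simp only [List.length_replicate, List.length_append] at hlen
        have hp₁ : p₁ = List.replicate p₁.length false :=
          List.eq_replicate_of_mem fun x hx => by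
            have : x ∈ List.replicate k false := by rw [e]; simp [hx]
            exact (List.mem_replicate.1 this).2
        rw [hap, hp₁, ← List.replicate_succ, ih _ (by omega), zero_mul]
  rcases eq_replicate_false_or u with ⟨n, rfl⟩ | ⟨k, u, rfl⟩
  · rw [← List.replicate_succ', List.replicate_succ, h.t_false_cons]
  · rw [List.append_assoc, List.cons_append, ← List.replicate_succ', key]

theorem t_insert_false (h : ConjugationData μ ν f g b t E) (u v : List Bool) (n : ℕ) :
    t (u ++ true :: (List.replicate n false ++ true :: v)) = ν n * t (u ++ true :: true :: v) := by
  rcases List.eq_nil_or_concat v with rfl | ⟨v, x, rfl⟩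
  · have h1 := h.t_append_true (u ++ true :: List.replicate n false)
    have h2 := h.t_append_true (u ++ [true])
    simp only [List.append_assoc, List.cons_append, List.nil_append] at h1 h2
    rw [h1, h2, h.leftProduct_insert_false]
  · cases x
    · have h1 := h.t_append_false (u ++ true :: (List.replicate n false ++ true :: v))
      have h2 := h.t_append_false (u ++ true :: true :: v)
      simp only [List.append_assoc, List.cons_append] at h1 h2
      rw [List.concat_eq_append, h1, h2, mul_zero]
    · have h1 := h.t_append_true (u ++ true :: (List.replicate n false ++ true :: v))
      have h2 := h.t_append_true (u ++ true :: true :: v)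
      simp only [List.append_assoc, List.cons_append] at h1 h2
      rw [List.concat_eq_append, h1, h2, h.leftProduct_insert_false]

theorem t_replicate_true (h : ConjugationData μ ν f g b t E) (n : ℕ) :
    t (List.replicate (n + 1) true) = b (List.replicate (n + 1) true) := by
  have := h.t_append_true (List.replicate n true)
  rw [← List.replicate_succ'] at this
  rw [this, List.replicate_succ, leftProduct, selSum_replicate_true h.g_nil h.g_of_mem]

theorem E_replicate_true (h : ConjugationData μ ν f g b t E) (n : ℕ) :
    E (List.replicate n true) = f (List.replicate n true) := by
  induction n using Nat.strong_induction_on with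
  | _ n ih =>
    cases n with
    | zero => simp [h.E_nil, h.f_nil]
    | succ n =>
      rw [List.replicate_succ, h.E_cons, h.f_cons]
      refine prefixSum_congr fun p r e => ?_
      have hp : p = List.replicate p.length true := List.eq_replicate_of_mem fun x hx => by
        have : x ∈ List.replicate n true := by rw [e]; simp [hx]
        exact (List.mem_replicate.1 this).2
      have hr : r = List.replicate r.length true := List.eq_replicate_of_mem fun x hx => by
        have : x ∈ List.replicate n true := by rw [e]; simp [hx]
        exact (List.mem_replicate.1 this).2
      have hlen := congrArg List.length e
      simp only [List.length_replicate, List.length_append] at hlen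
      rw [hp, hr, ← List.replicate_succ]
      exact ⟨h.t_replicate_true _, ih _ (by simp; omega)⟩

theorem E_false_cons (h : ConjugationData μ ν f g b t E) (l : List Bool) :
    E (false :: l) = 0 := by
  have h0 : (fun s => t (false :: s)) = fun _ => 0 := funext fun s => h.t_false_cons s
  rw [h.E_cons, h0, prefixSum_zero_left]

theorem E_append_false (h : ConjugationData μ ν f g b t E) (l : List Bool) :
    E (l ++ [false]) = 0 := by
  induction hn : l.length using Nat.strong_induction_on generalizing l with
  | _ n ih =>
    subst hn
    cases l with
    | nil => exact h.E_false_cons []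
    | cons a l =>
      rw [List.cons_append, h.E_cons, prefixSum_eq_last _ h.E_nil, ← List.cons_append,
        h.t_append_false]
      intro p r e hr
      obtain ⟨r', x, rfl⟩ := (List.eq_nil_or_concat r).resolve_left hr
      rw [List.concat_eq_append] at e ⊢
      rw [← List.append_assoc] at e
      obtain ⟨h1, h2⟩ := List.append_inj' e rfl
      rw [← h2, ih _ _ r' rfl, mul_zero]
      simp [h1]

/-- The factorizations of the word into blocks weighted by `t`, when they have a cut next to or
inside the inserted letters, involve a block that begins or ends with `false`. In the others the
block that contains the inserted letters produces the factor `ν (k + 1)`. The first block is split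
off, and the induction is on the length of `u`. -/
theorem E_insert_false (h : ConjugationData μ ν f g b t E) (u v : List Bool) (k : ℕ) :
    E (u ++ true :: (List.replicate (k + 1) false ++ true :: v))
      = ν (k + 1) * (E (u ++ true :: true :: v) - E (u ++ [true]) * E (true :: v)) := by
  induction hn : u.length using Nat.strong_induction_on generalizing u with
  | _ n ih =>
    subst hn
    obtain ⟨a, p, hp⟩ : ∃ a p, u ++ [true] = a :: p := by
      cases u with
      | nil => exact ⟨_, _, rfl⟩
      | cons a u => exact ⟨_, _, rfl⟩
    have hap : ∀ s, u ++ true :: s = a :: (p ++ s) := fun s => by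
      rw [← List.cons_append, ← hp]; simp
    have hlp : p.length = u.length := by simpa using (congrArg List.length hp).symm
    -- blocks of the factorization that end before the inserted letters
    have hbefore : properPrefixSum (fun s => t (a :: s))
          (fun s => E (s ++ (List.replicate (k + 1) false ++ true :: v))) p
        = properPrefixSum (fun s => t (a :: s))
          (fun s => ν (k + 1) * (E (s ++ true :: v) - E s * E (true :: v))) p := by
      refine properPrefixSum_congr ?_
      rintro p₁ r rfl hr
      obtain ⟨r', x, rfl⟩ := (List.eq_nil_or_concat r).resolve_left hr
      rw [List.concat_eq_append] at hp hlp ⊢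
      have h2 : u ++ [true] = (a :: (p₁ ++ r')) ++ [x] := by simpa using hp
      have hx := (List.append_inj' h2 rfl).2
      simp only [List.cons.injEq, and_true] at hx
      subst hx
      have := ih r'.length (by simp at hlp; omega) r' rfl
      simp only [List.append_assoc, List.singleton_append, this]
    -- blocks that end inside the inserted letters contribute nothing
    have hinside : properPrefixSum (fun s => t (a :: (p ++ s)))
        (fun s => E (s ++ true :: v)) (List.replicate (k + 1) false) = 0 := by
      refine properPrefixSum_eq_zero fun p₁ r e hr => ?_
      obtain ⟨x, r, rfl⟩ := List.exists_cons_of_ne_nil hr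
      have : x ∈ List.replicate (k + 1) false := by rw [e]; simp
      rw [(List.mem_replicate.1 this).2, List.cons_append, h.E_false_cons, mul_zero]
    have hend : t (a :: (p ++ List.replicate (k + 1) false)) = 0 := by
      rw [← hap, List.replicate_succ', ← List.cons_append, ← List.append_assoc, h.t_append_false]
    have hafter : (fun s => t (a :: (p ++ (List.replicate (k + 1) false ++ true :: s))))
        = fun s => ν (k + 1) * t (a :: (p ++ true :: s)) := funext fun s => by
      rw [← hap, ← hap, h.t_insert_false]
    rw [hap, hap, hp, h.E_cons, h.E_cons, h.E_cons, prefixSum_append, hbefore,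
      properPrefixSum_linear, prefixSum_append _ _ (List.replicate (k + 1) false), hinside,
      zero_add, prefixSum, List.append_nil, hend, zero_mul, zero_add, hafter, prefixSum_mul_left,
      prefixSum_append _ _ p (true :: v), prefixSum_eq _ _ p, prefixSum, h.E_nil, List.append_nil]
    ring

theorem isOrthogonalOnWords (h : ConjugationData μ ν f g b t E) : IsOrthogonalOnWords μ ν E where
  replicate_true n := by rw [h.E_replicate_true, h.f_true]
  false_cons := h.E_false_cons
  append_false := h.E_append_false
  insert_false := h.E_insert_false

end ConjugationData

/-! ### Models of the orthogonal convolution -/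

section Models

variable {B : Type v} [Ring B]

/-- The value at `(x, y)` of a noncommutative monomial, with `true` standing for `x` and `false`
for `y`. -/
def monomialEval (x y : B) (l : List Bool) : B := (l.map fun c => if c then x else y).prod

theorem monomialEval_append (x y : B) (l l' : List Bool) :
    monomialEval x y (l ++ l') = monomialEval x y l * monomialEval x y l' := by
  simp [monomialEval]

theorem monomialEval_cons (x y : B) (c : Bool) (l : List Bool) :
    monomialEval x y (c :: l) = (if c then x else y) * monomialEval x y l := by
  simp [monomialEval]

theorem monomialEval_replicate (x y : B) (c : Bool) (n : ℕ) :
    monomialEval x y (List.replicate n c) = (if c then x else y) ^ n := by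
  simp [monomialEval]

variable [Algebra ℂ B]

theorem pow_succ_mem_adjoin (x : B) (n : ℕ) : x ^ (n + 1) ∈ NonUnitalAlgebra.adjoin ℂ {x} := by
  induction n with
  | zero => simp
  | succ n ih =>
    rw [pow_succ]
    exact mul_mem ih (NonUnitalAlgebra.subset_adjoin ℂ (Set.mem_singleton x))

theorem mem_span_pow_of_mem_adjoin {x b : B} (hb : b ∈ NonUnitalAlgebra.adjoin ℂ {x}) :
    b ∈ Submodule.span ℂ (Set.range fun n : ℕ => x ^ (n + 1)) := by
  induction hb using NonUnitalAlgebra.adjoin_induction with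
  | mem y hy =>
    rw [Set.mem_singleton_iff.1 hy]
    exact Submodule.subset_span ⟨0, by simp⟩
  | add y z _ _ hy hz => exact add_mem hy hz
  | zero => exact zero_mem _
  | mul y z _ _ hy hz =>
    have h := Submodule.mul_mem_mul hy hz
    rw [Submodule.span_mul_span] at h
    refine Submodule.span_mono ?_ h
    rintro _ ⟨_, ⟨m, rfl⟩, _, ⟨n, rfl⟩, rfl⟩
    exact ⟨m + 1 + n, by simp only [← pow_add]; congr 1⟩
  | smul r y _ hy => exact Submodule.smul_mem _ _ hy

theorem monomialEval_mem (x y : B) (l : List Bool) :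
    monomialEval x y l ∈ Algebra.adjoin ℂ ((NonUnitalAlgebra.adjoin ℂ {x} : Set B) ∪
      (NonUnitalAlgebra.adjoin ℂ {y} : Set B)) := by
  induction l with
  | nil => simp [monomialEval]
  | cons c l ih =>
    rw [monomialEval_cons]
    refine mul_mem (Algebra.subset_adjoin ?_) ih
    cases c
    · exact Or.inr (by simp)
    · exact Or.inl (by simp)

/-- Every orthogonal pair satisfies the relations on words in `x` and `y`. -/
theorem IsOrthogonal.isOrthogonalOnWords {φ ψ : B →ₗ[ℂ] ℂ} {x y : B}
    (h : IsOrthogonal φ ψ (NonUnitalAlgebra.adjoin ℂ {x}) (NonUnitalAlgebra.adjoin ℂ {y})) :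
    IsOrthogonalOnWords (fun n => φ (x ^ n)) (fun n => ψ (y ^ n))
      fun l => φ (monomialEval x y l) where
  replicate_true n := by rw [monomialEval_replicate]; simp
  false_cons l := by
    rw [monomialEval_cons]
    exact (h.1 y (by simp) _ (monomialEval_mem x y l)).1
  append_false l := by
    rw [monomialEval_append]
    have := (h.1 y (by simp) _ (monomialEval_mem x y l)).2
    simpa [monomialEval] using this
  insert_false u v k := by
    have hx : x ∈ NonUnitalAlgebra.adjoin ℂ {x} := by simp
    have := h.2 x hx x hx _ (pow_succ_mem_adjoin y k) _ (monomialEval_mem x y u) _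
      (monomialEval_mem x y v)
    simpa only [monomialEval_append, monomialEval_cons, monomialEval_replicate, if_true,
      Bool.false_eq_true, if_false, mul_assoc, show monomialEval x y [] = 1 from rfl,
      mul_one] using this

/-- If the monomials in `x` and `y` span, orthogonality can be tested on monomials. -/
theorem IsOrthogonalOnWords.isOrthogonal {φ ψ : B →ₗ[ℂ] ℂ} {x y : B} {μ : ℕ → ℂ}
    (hspan : Submodule.span ℂ (Set.range (monomialEval x y)) = ⊤)
    (h : IsOrthogonalOnWords μ (fun n => ψ (y ^ n)) fun l => φ (monomialEval x y l)) :
    IsOrthogonal φ ψ (NonUnitalAlgebra.adjoin ℂ {x}) (NonUnitalAlgebra.adjoin ℂ {y}) := by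
  have hmem : ∀ z : B, z ∈ Submodule.span ℂ (Set.range (monomialEval x y)) := by simp [hspan]
  constructor
  · intro b hb z hz
    replace hb := mem_span_pow_of_mem_adjoin hb
    replace hz := hmem z
    induction hb using Submodule.span_induction with
    | zero => simp
    | add b b' _ _ h1 h2 => simp [add_mul, mul_add, h1.1, h1.2, h2.1, h2.2]
    | smul c b _ h1 => simp [h1.1, h1.2]
    | mem b hb =>
      obtain ⟨n, rfl⟩ := hb
      induction hz using Submodule.span_induction with
      | zero => simp
      | add b b' _ _ h1 h2 => simp [add_mul, mul_add, h1.1, h1.2, h2.1, h2.2]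
      | smul c b _ h1 => simp [h1.1, h1.2]
      | mem z hz =>
        obtain ⟨l, rfl⟩ := hz
        dsimp only
        have hy : y ^ (n + 1) = monomialEval x y (List.replicate (n + 1) false) := by
          simp [monomialEval_replicate]
        constructor
        · rw [hy, ← monomialEval_append, List.replicate_succ]
          exact h.false_cons _
        · rw [hy, ← monomialEval_append, List.replicate_succ', ← List.append_assoc]
          exact h.append_false _
  · intro a₁ ha₁ a₂ ha₂ b hb z₁ hz₁ z₂ hz₂
    replace ha₁ := mem_span_pow_of_mem_adjoin ha₁
    replace ha₂ := mem_span_pow_of_mem_adjoin ha₂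
    replace hb := mem_span_pow_of_mem_adjoin hb
    replace hz₁ := hmem z₁
    replace hz₂ := hmem z₂
    induction ha₁ using Submodule.span_induction with
    | zero => simp
    | add _ _ _ _ h1 h2 => simp only [add_mul, mul_add, map_add, h1, h2]; ring
    | smul c _ _ h1 =>
      simp only [mul_smul_comm, smul_mul_assoc, map_smul, smul_eq_mul, h1]; ring
    | mem a₁ ha₁ =>
    obtain ⟨m, rfl⟩ := ha₁
    induction ha₂ using Submodule.span_induction with
    | zero => simp
    | add _ _ _ _ h1 h2 => simp only [add_mul, mul_add, map_add, h1, h2]; ring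
    | smul c _ _ h1 =>
      simp only [mul_smul_comm, smul_mul_assoc, map_smul, smul_eq_mul, h1]; ring
    | mem a₂ ha₂ =>
    obtain ⟨n, rfl⟩ := ha₂
    induction hb using Submodule.span_induction with
    | zero => simp
    | add _ _ _ _ h1 h2 => simp only [add_mul, mul_add, map_add, h1, h2]
    | smul c _ _ h1 =>
      simp only [mul_smul_comm, smul_mul_assoc, map_smul, smul_eq_mul, h1]; ring
    | mem b hb =>
    obtain ⟨k, rfl⟩ := hb
    induction hz₁ using Submodule.span_induction with
    | zero => simp
    | add _ _ _ _ h1 h2 => simp only [add_mul, map_add, h1, h2]; ring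
    | smul c _ _ h1 =>
      simp only [smul_mul_assoc, map_smul, smul_eq_mul, h1]; ring
    | mem z₁ hz₁ =>
    obtain ⟨u, rfl⟩ := hz₁
    induction hz₂ using Submodule.span_induction with
    | zero => simp
    | add _ _ _ _ h1 h2 => simp only [mul_add, map_add, h1, h2]; ring
    | smul c _ _ h1 =>
      simp only [mul_smul_comm, map_smul, smul_eq_mul, h1]; ring
    | mem z₂ hz₂ =>
    obtain ⟨v, rfl⟩ := hz₂
    have := h.insert_false (u ++ List.replicate m true) (List.replicate n true ++ v) k
    simpa only [monomialEval_append, monomialEval_cons, monomialEval_replicate, if_true,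
      Bool.false_eq_true, if_false, mul_assoc, show monomialEval x y [] = 1 from rfl,
      mul_one, pow_succ x m, pow_succ' x n] using this

theorem basisFreeMonoid_ofList {X : Type v} (l : List X) :
    FreeAlgebra.basisFreeMonoid ℂ X (FreeMonoid.ofList l) = (l.map (FreeAlgebra.ι ℂ)).prod := by
  have : FreeAlgebra.basisFreeMonoid ℂ X (FreeMonoid.ofList l)
      = MonoidAlgebra.lift ℂ (FreeAlgebra ℂ X) (FreeMonoid X) (FreeMonoid.lift (FreeAlgebra.ι ℂ))
        (MonoidAlgebra.of ℂ (FreeMonoid X) (FreeMonoid.ofList l)) := by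
    rw [FreeAlgebra.basisFreeMonoid, Module.Basis.map_apply]
    rfl
  rw [this, MonoidAlgebra.lift_of, FreeMonoid.lift_ofList]

/-- The first and second generator of the free algebra on two generators. -/
def freeVar (c : Bool) : FreeAlgebra ℂ (ULift.{v} Bool) := FreeAlgebra.ι ℂ (ULift.up c)

theorem basisFreeMonoid_map_up (l : List Bool) :
    FreeAlgebra.basisFreeMonoid ℂ (ULift.{v} Bool) (FreeMonoid.ofList (l.map ULift.up))
      = monomialEval (freeVar true) (freeVar false) l := by
  rw [basisFreeMonoid_ofList, monomialEval, List.map_map]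
  congr 1
  refine List.map_congr_left fun c _ => ?_
  cases c <;> rfl

theorem span_monomialEval_freeVar : Submodule.span ℂ (Set.range
    (monomialEval (freeVar.{v} true) (freeVar false))) = ⊤ := by
  rw [eq_top_iff, ← (FreeAlgebra.basisFreeMonoid ℂ (ULift.{v} Bool)).span_eq]
  refine Submodule.span_mono ?_
  rintro _ ⟨m, rfl⟩
  refine ⟨(FreeMonoid.toList m).map ULift.down, ?_⟩
  rw [← basisFreeMonoid_map_up]
  simp [Function.comp_def]

theorem exists_linearMap_monomialEval (m : List Bool → ℂ) :
    ∃ φ : FreeAlgebra ℂ (ULift.{v} Bool) →ₗ[ℂ] ℂ,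
      ∀ l, φ (monomialEval (freeVar true) (freeVar false) l) = m l := by
  refine ⟨(FreeAlgebra.basisFreeMonoid ℂ (ULift.{v} Bool)).constr ℂ
    fun w => m ((FreeMonoid.toList w).map ULift.down), fun l => ?_⟩
  rw [← basisFreeMonoid_map_up, Module.Basis.constr_basis]
  simp [Function.comp_def]

end Models

section Expansion

variable {A : Type u} [AddCommGroup A] [Module ℂ A]

/-- Words are additive in each letter. -/
theorem listWord_append_add (u v : List A) (a b : A) :
    listWord (u ++ (a + b) :: v) = listWord (u ++ a :: v) + listWord (u ++ b :: v) := by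
  have hw : ∀ c : A, listWord (u ++ c :: v) = word A (u.length + (v.length + 1))
      (Function.update (fun p => (u ++ 0 :: v).get (p.cast (by simp))) ⟨u.length, by omega⟩ c) := by
    intro c
    refine (word_eq_listWord_of_length _ (by simp) _ fun p => ?_).symm
    by_cases hp : p = ⟨u.length, by omega⟩
    · subst hp; simp
    · rw [Function.update_of_ne hp]
      have hp' : p.val ≠ u.length := fun h => hp (Fin.ext h)
      simp only [List.get_eq_getElem, Fin.val_cast, List.getElem_append]
      split
      · rfl
      · obtain ⟨j, hj⟩ : ∃ j, p.val - u.length = j + 1 := ⟨p.val - u.length - 1, by omega⟩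
        simp [hj]
  rw [hw, hw, hw, MultilinearMap.map_update_add]

/-- Expanding the powers of `x + y` and of the word letter `c true + c false` gives the same
monomials. The monomial `u` carries the letters already expanded. -/
theorem apply_mul_add_pow {B : Type v} [Ring B] [Algebra ℂ B] {φ : B →ₗ[ℂ] ℂ} {x y : B}
    {F : Functional A} {c : Bool → A}
    (h : ∀ l, φ (monomialEval x y l) = F (listWord (l.map c))) (n : ℕ) (u : List Bool) :
    φ (monomialEval x y u * (x + y) ^ n)
      = F (listWord (u.map c ++ List.replicate n (c true + c false))) := by
  induction n generalizing u with
  | zero => simp [h]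
  | succ n ih =>
    have h1 := ih (u ++ [true])
    have h2 := ih (u ++ [false])
    simp only [monomialEval_append, List.map_append, List.append_assoc, List.map_cons,
      List.map_nil, List.cons_append, List.nil_append] at h1 h2
    rw [List.replicate_succ, listWord_append_add, map_add, ← h1, ← h2, ← map_add, ← add_mul,
      ← mul_add, pow_succ', ← mul_assoc]
    simp [monomialEval]

theorem apply_listWord_of_extendsAt {ι : Type w} {e : Module.Basis ι ℂ A} {i : ι}
    {μ : Polynomial ℂ →ₗ[ℂ] ℂ} {F : Functional A} (h : ExtendsAt e i μ F) (j : Bool → ι)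
    (l : List Bool) :
    ((∀ c ∈ l, j c = i) → F (listWord (l.map fun c => e (j c))) = μ (Polynomial.X ^ l.length)) ∧
    ((∃ c ∈ l, j c ≠ i) → F (listWord (l.map fun c => e (j c))) = 0) := by
  have hw : listWord (l.map fun c => e (j c)) = word A l.length fun k => e (j (l.get k)) :=
    (word_eq_listWord_of_length _ (by simp) _ (by simp)).symm
  rw [hw]
  refine ⟨fun hl => (h l.length fun k => j (l.get k)).1 fun k => hl _ (List.get_mem l k), ?_⟩
  rintro ⟨c, hc, hne⟩
  obtain ⟨k, rfl⟩ := List.get_of_mem hc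
  exact (h l.length fun k => j (l.get k)).2 ⟨k, hne⟩

/-- The values of the given functionals on words in two letters of the alphabet. -/
theorem conjugationData {ι : Type w} (e : Module.Basis ι ℂ A) {i j : ι} (hij : i ≠ j)
    {μ ν : Polynomial ℂ →ₗ[ℂ] ℂ} {Φ Ψ β : Functional A} (hΨ : IsCharacter Ψ)
    (hβ : IsInfinitesimal β) (hΦβ : Φ = rightExp β) (hμ : ExtendsAt e i μ Φ)
    (hν : ExtendsAt e j ν Ψ) :
    ConjugationData (fun n => μ (Polynomial.X ^ n)) (fun n => ν (Polynomial.X ^ n))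
      (fun l => Φ (listWord (l.map fun c => e (if c then i else j))))
      (fun l => Ψ (listWord (l.map fun c => e (if c then i else j))))
      (fun l => β (listWord (l.map fun c => e (if c then i else j))))
      (fun l => adjoint Ψ β (listWord (l.map fun c => e (if c then i else j))))
      (fun l => rightExp (adjoint Ψ β) (listWord (l.map fun c => e (if c then i else j)))) := by
  have hθ := isInfinitesimal_adjoint hΨ hβ
  have hΦ : IsCharacter Φ := hΦβ ▸ isCharacter_rightExp hβ
  refine ⟨fun n => ?_, fun l hl => ?_, fun n => ?_, fun l hl => ?_, ?_, ?_, ?_, fun a l => ?_,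
    fun a l => ?_, fun a l => ?_⟩
  · have := (apply_listWord_of_extendsAt hμ (fun c => if c then i else j)
      (List.replicate n true)).1
      fun c hc => by simp [List.eq_of_mem_replicate hc]
    rwa [List.length_replicate] at this
  · exact (apply_listWord_of_extendsAt hμ (fun c => if c then i else j) l).2
      ⟨false, hl, by simpa using hij.symm⟩
  · have := (apply_listWord_of_extendsAt hν (fun c => if c then i else j)
      (List.replicate n false)).1
      fun c hc => by simp [List.eq_of_mem_replicate hc]
    rwa [List.length_replicate] at this
  · exact (apply_listWord_of_extendsAt hν (fun c => if c then i else j) l).2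
      ⟨true, hl, by simpa using hij⟩
  · simpa using hΦ.1
  · simpa using hΨ.1
  · simpa using (isCharacter_rightExp hθ).1
  · subst hΦβ
    simp only [List.map_cons]
    rw [rightExp_listWord_cons hβ, prefixSum_map]
  · simp only [List.map_cons]
    rw [rightExp_listWord_cons hθ, prefixSum_map]
  · have h := LinearMap.congr_fun ((eq_adjoint_iff hΨ.1 hθ.1).1 rfl)
      (listWord ((a :: l).map fun c => e (if c then i else j)))
    simp only [List.map_cons] at h ⊢
    rwa [halfRight_listWord_cons _ hθ, halfLeft_listWord_cons _ hΨ, prefixSum_map, selSum_map] at h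

theorem isOrthogonalConvolution_iff {ι : Type w} (e : Module.Basis ι ℂ A) {i j : ι} (hij : i ≠ j)
    {μ ν : Polynomial ℂ →ₗ[ℂ] ℂ} {Φ Ψ β : Functional A} (hΨ : IsCharacter Ψ)
    (hβ : IsInfinitesimal β) (hΦβ : Φ = rightExp β) (hμ : ExtendsAt e i μ Φ)
    (hν : ExtendsAt e j ν Ψ) (η : Polynomial ℂ →ₗ[ℂ] ℂ) :
    IsOrthogonalConvolution.{v} μ ν η ↔ ∀ n : ℕ, η (Polynomial.X ^ n)
      = rightExp (adjoint Ψ β) (word A n fun _ => e i + e j) := by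
  have hdata := conjugationData e hij hΨ hβ hΦβ hμ hν
  have hE := hdata.isOrthogonalOnWords
  have hword : ∀ n, word A n (fun _ => e i + e j) = listWord (List.replicate n (e i + e j)) :=
    fun n => by rw [word_eq_listWord, List.ofFn_const]
  constructor
  · rintro ⟨B, _, _, φ, ψ, x, y, -, -, horth, hx, hy, hη⟩ n
    have hm := horth.isOrthogonalOnWords
    simp only [← hx, ← hy] at hm
    have := apply_mul_add_pow (c := fun c => e (if c then i else j)) (hm.unique hE) n []
    rw [hη, hword]
    simpa [monomialEval] using this
  · intro hη
    obtain ⟨φ, hφ⟩ := exists_linearMap_monomialEval.{v} fun l =>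
      rightExp (adjoint Ψ β) (listWord (l.map fun c => e (if c then i else j)))
    obtain ⟨ψ, hψ⟩ := exists_linearMap_monomialEval.{v} fun l =>
      Ψ (listWord (l.map fun c => e (if c then i else j)))
    have hxφ : ∀ n, φ (freeVar true ^ n) = μ (Polynomial.X ^ n) := fun n => by
      rw [← hE.replicate_true n, ← hφ, monomialEval_replicate, if_pos rfl]
    have hyψ : ∀ n, ψ (freeVar false ^ n) = ν (Polynomial.X ^ n) := fun n => by
      rw [← hdata.g_false n, ← hψ, monomialEval_replicate]; simp
    refine ⟨FreeAlgebra ℂ (ULift.{v} Bool), inferInstance, inferInstance, φ, ψ, freeVar true,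
      freeVar false, ?_, ?_, ?_, fun n => (hxφ n).symm, fun n => (hyψ n).symm, fun n => ?_⟩
    · exact (hφ []).trans hdata.E_nil
    · exact (hψ []).trans hdata.g_nil
    · refine IsOrthogonalOnWords.isOrthogonal (μ := fun n => μ (Polynomial.X ^ n))
        span_monomialEval_freeVar ?_
      simpa only [hφ, hyψ] using hE
    · have := apply_mul_add_pow (c := fun c => e (if c then i else j)) hφ n []
      rw [hη, hword]
      simpa [monomialEval] using this.symm

end Expansion

end OrthogonalIndependence

theorem mainTheorem9 {A : Type u} [Ring A] [Algebra ℂ A]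
    (Φ Ψ β : DoubleTensor.Functional A)
    (hΦ : DoubleTensor.IsCharacter Φ) (hΨ : DoubleTensor.IsCharacter Ψ)
    (hβ : DoubleTensor.IsInfinitesimal β) (hΦβ : Φ = DoubleTensor.rightExp β) :
    DoubleTensor.IsConvInv Ψ (DoubleTensor.convInv Ψ) ∧
    DoubleTensor.IsInfinitesimal (DoubleTensor.adjoint Ψ β) ∧
    DoubleTensor.IsCharacter (DoubleTensor.rightExp (DoubleTensor.adjoint Ψ β)) ∧
    (∀ {ι : Type w} (e : Module.Basis ι ℂ A) (i j : ι), i ≠ j →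
      ∀ μ ν : Polynomial ℂ →ₗ[ℂ] ℂ,
        DoubleTensor.IsDistribution μ → DoubleTensor.IsDistribution ν →
        DoubleTensor.ExtendsAt e i μ Φ → DoubleTensor.ExtendsAt e j ν Ψ →
        ∀ η : Polynomial ℂ →ₗ[ℂ] ℂ,
          OrthogonalIndependence.IsOrthogonalConvolution.{v} μ ν η ↔
            ∀ n : ℕ, η (Polynomial.X ^ n)
              = DoubleTensor.rightExp (DoubleTensor.adjoint Ψ β)
                  (DoubleTensor.word A n fun _ => e i + e j)) ∧
    (∀ ρ' : DoubleTensor.Functional A, DoubleTensor.IsInfinitesimal ρ' →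
      Ψ = DoubleTensor.convExp ρ' →
        DoubleTensor.LocallyFinite (DoubleTensor.preLieExpTerm ρ' β) ∧
        DoubleTensor.rightExp (DoubleTensor.adjoint Ψ β)
          = DoubleTensor.rightExp (DoubleTensor.preLieExp ρ' β)) := by
  have hθ := DoubleTensor.isInfinitesimal_adjoint hΨ hβ
  refine ⟨DoubleTensor.isConvInv_convInv hΨ.1, hθ, DoubleTensor.isCharacter_rightExp hθ, ?_, ?_⟩
  · intro ι e i j hij μ ν _ _ hμ hν η
    exact OrthogonalIndependence.isOrthogonalConvolution_iff e hij hΨ hβ hΦβ hμ hν η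
  · rintro ρ' hρ rfl
    exact ⟨DoubleTensor.locallyFinite_of_mem_vanishBelow
      (DoubleTensor.preLieExpTerm_mem_vanishBelow hβ.1 hρ.1),
      by rw [DoubleTensor.preLieExp_eq_adjoint hβ.1 hρ.1 hΨ.1]⟩
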